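/- Let $k$ be an algebraically closed field, let $R$ be a finitely generated reduced commutative $k$-algebra, and let $\sigma$ be a $k$-algebra automorphism of $R$. Let $S=R[x^{\pm 1};\sigma]$ be the skew Laurent polynomial ring, in which $x r=\sigma(r)x$ for $r\in R$, and let $P$ be a prime (two-sided) ideal of $S$. Then $P$ is rational if and only if one of the following holds: (i) $P$ is a maximal two-sided ideal of $S$; or (ii) $P\cap R$ has infinite codimension in $R$ (that is, $\dim_k R/(P\cap R)=\infty$), $P=(P\cap R)S$, and the automorphism of $X=\mathrm{Spec}(R/(P\cap R))$ induced by $\sigma$ does not preserve a non-constant fibration. Here a prime ideal $P$ of $S$ is called rational if the centre of $Q(S/P)$ is algebraic over $k$, where $Q(S/P)$ is the Goldie ring of quotients, i.e. the (existing) Ore localization of $S/P$ at the set of elements that are neither left nor right zero divisors. An automorphism $\Phi$ of a (possibly reducible) affine variety $X$ preserves a non-constant fibration if there is a rational map $f:X\dashrightarrow\mathbb{P}^1$ with $f\circ\Phi=f$ such that $f$ is defined and non-constant on a dense open subset of some irreducible component of $X$. -/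

import Mathlib

/-! ### Skew Laurent polynomial rings -/

section SkewLaurent

variable {k R : Type*} [CommSemiring k] [CommRing R] [Algebra k R]

/-- The action of `ℤ` on `R` in which `n` acts as `σ ^ n`. -/
@[reducible] noncomputable def skewAction (σ : R ≃ₐ[k] R) :
    MulSemiringAction (Multiplicative ℤ) R :=
  MulSemiringAction.compHom R (zpowersHom (R ≃ₐ[k] R) σ)

/-- The skew Laurent polynomial ring `R[x^{±1}; σ]`: finite sums `∑ r_n x^n` with `n ∈ ℤ` and
`r_n ∈ R`, multiplied by the rule `x * r = σ r * x`. -/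
def SkewLaurent (σ : R ≃ₐ[k] R) : Type _ :=
  let _ := σ
  SkewMonoidAlgebra R (Multiplicative ℤ)

namespace SkewLaurent

noncomputable instance instRing (σ : R ≃ₐ[k] R) : Ring (SkewLaurent σ) :=
  letI := skewAction σ
  inferInstanceAs (Ring (SkewMonoidAlgebra R (Multiplicative ℤ)))

/-- The term `r x^n`. -/
noncomputable def monomial (σ : R ≃ₐ[k] R) (n : ℤ) (r : R) : SkewLaurent σ :=
  (SkewMonoidAlgebra.single (Multiplicative.ofAdd n) r : SkewMonoidAlgebra R (Multiplicative ℤ))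

theorem monomial_mul_monomial (σ : R ≃ₐ[k] R) (m n : ℤ) (r s : R) :
    monomial σ m r * monomial σ n s = monomial σ (m + n) (r * (σ ^ m) s) := by
  let := skewAction σ
  exact SkewMonoidAlgebra.single_mul_single

/-- The inclusion of `R` into `R[x^{±1}; σ]` as the constant terms. -/
noncomputable def C (σ : R ≃ₐ[k] R) : R →+* SkewLaurent σ where
  toFun r := monomial σ 0 r
  map_one' := rfl
  map_zero' := SkewMonoidAlgebra.single_zero _
  map_add' _ _ := SkewMonoidAlgebra.single_add ..
  map_mul' r s := by simp [monomial_mul_monomial]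

/-- `R[x^{±1}; σ]` is a `k`-algebra through `k → R`, since `σ` fixes `k`. -/
noncomputable instance instAlgebra (σ : R ≃ₐ[k] R) : Algebra k (SkewLaurent σ) :=
  RingHom.toAlgebra' ((C σ).comp (algebraMap k R)) fun c f => by
    have key : ∀ f : SkewMonoidAlgebra R (Multiplicative ℤ),
        (C σ (algebraMap k R c)) * (show SkewLaurent σ from f) =
          (show SkewLaurent σ from f) * C σ (algebraMap k R c) := by
      intro f
      induction f using SkewMonoidAlgebra.induction_on' with
      | single g a =>
        change monomial σ 0 (algebraMap k R c) * monomial σ g.toAdd a =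
          monomial σ g.toAdd a * monomial σ 0 (algebraMap k R c)
        simp [monomial_mul_monomial, mul_comm]
      | add f g hf hg =>
        let f' : SkewLaurent σ := f
        let g' : SkewLaurent σ := g
        change C σ (algebraMap k R c) * (f' + g') = (f' + g') * C σ (algebraMap k R c)
        rw [mul_add, add_mul]
        exact congrArg₂ (· + ·) hf hg
    exact key f

/-- The contraction `P ∩ R` of a two-sided ideal `P` of `R[x^{±1}; σ]`. -/
noncomputable def contraction (σ : R ≃ₐ[k] R) (P : TwoSidedIdeal (SkewLaurent σ)) : Ideal R :=
  P.asIdeal.comap (C σ)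

/-- For an ideal `I` of `R`, the right ideal `I S` of `S = R[x^{±1}; σ]`, i.e. the set of all finite
sums of products `a * s` with `a ∈ I` and `s ∈ S`. -/
noncomputable def extension (σ : R ≃ₐ[k] R) (I : Ideal R) :
    Submodule (SkewLaurent σ)ᵐᵒᵖ (SkewLaurent σ) :=
  Submodule.span (SkewLaurent σ)ᵐᵒᵖ (C σ '' (I : Set R))

theorem mem_contraction_apply (σ : R ≃ₐ[k] R) (P : TwoSidedIdeal (SkewLaurent σ)) (r : R) :
    σ r ∈ contraction σ P ↔ r ∈ contraction σ P := by
  have h1 : monomial σ 1 1 * C σ r * monomial σ (-1) 1 = C σ (σ r) := by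
    change monomial σ 1 1 * monomial σ 0 r * monomial σ (-1) 1 = monomial σ 0 (σ r)
    simp [monomial_mul_monomial]
  have h2 : monomial σ (-1) 1 * C σ (σ r) * monomial σ 1 1 = C σ r := by
    change monomial σ (-1) 1 * monomial σ 0 (σ r) * monomial σ 1 1 = monomial σ 0 r
    rw [monomial_mul_monomial, monomial_mul_monomial]
    simp
  simp only [contraction, Ideal.mem_comap, TwoSidedIdeal.mem_asIdeal]
  constructor
  · intro h
    rw [← h2]
    exact P.mul_mem_right _ _ (P.mul_mem_left _ _ h)
  · intro h
    rw [← h1]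
    exact P.mul_mem_right _ _ (P.mul_mem_left _ _ h)

theorem map_contraction (σ : R ≃ₐ[k] R) (P : TwoSidedIdeal (SkewLaurent σ)) :
    contraction σ P = (contraction σ P).map (σ : R →+* R) := by
  apply le_antisymm
  · intro r hr
    have h : σ.symm r ∈ contraction σ P := by
      rw [← mem_contraction_apply, σ.apply_symm_apply]; exact hr
    have h' := Ideal.mem_map_of_mem (σ : R →+* R) h
    simpa using h'
  · rw [Ideal.map_le_iff_le_comap]
    intro r hr
    exact (mem_contraction_apply σ P r).2 hr

/-- The automorphism of `R / (P ∩ R)` induced by `σ`. -/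
noncomputable def inducedAut (σ : R ≃ₐ[k] R) (P : TwoSidedIdeal (SkewLaurent σ)) :
    (R ⧸ contraction σ P) ≃ₐ[k] (R ⧸ contraction σ P) :=
  Ideal.quotientEquivAlg _ _ σ (map_contraction σ P)

end SkewLaurent

end SkewLaurent

/-! ### Prime, maximal and rational two-sided ideals -/

/-- A two-sided ideal `P` of a (noncommutative) ring is prime if it is proper and `J L ⊆ P`, for
two-sided ideals `J` and `L`, implies `J ⊆ P` or `L ⊆ P`. -/
def IsPrimeTwoSided {S : Type*} [Ring S] (P : TwoSidedIdeal S) : Prop :=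
  P ≠ ⊤ ∧ ∀ J L : TwoSidedIdeal S, (∀ a ∈ J, ∀ b ∈ L, a * b ∈ P) → J ≤ P ∨ L ≤ P

/-- A two-sided ideal is maximal if it is maximal among the proper two-sided ideals. -/
def IsMaximalTwoSided {S : Type*} [Ring S] (P : TwoSidedIdeal S) : Prop :=
  IsCoatom P

open scoped nonZeroDivisors in
/-- A prime ideal `P` of a `k`-algebra `S` is rational if the set of elements of `S / P` that are
neither left nor right zero divisors is an Ore set, and the centre of the ring of fractions
`Q(S / P)`, the localization of `S / P` at that set, is algebraic over `k`. -/
def IsRationalIdeal (k : Type*) {S : Type*} [Field k] [Ring S] [Algebra k S]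
    (P : TwoSidedIdeal S) : Prop :=
  IsPrimeTwoSided P ∧ ∃ _ : OreLocalization.OreSet ((S ⧸ P.asIdeal)⁰),
    Algebra.IsAlgebraic k
      (Subalgebra.center k (OreLocalization ((S ⧸ P.asIdeal)⁰) (S ⧸ P.asIdeal)))

/-! ### Invariant fibrations -/

/-- A rational map `f : X ⇢ ℙ¹` on the affine scheme `X = Spec A`, in homogeneous coordinates:
`f = [num : den]` with `num, den ∈ A`. The irreducible components of `X` are the `V(q)` for the
minimal primes `q` of `A`; the open set on which `num` and `den` do not both vanish has to be dense
in `X`, i.e. it has to meet every component. (A rational map `X ⇢ ℙ¹` is given by two elements of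
the total ring of fractions, and denominators can be cleared; both `[a : 0] = ∞` and `[0 : b] = 0`
are allowed on a component.) -/
structure RationalMapToP1 (A : Type*) [CommRing A] where
  num : A
  den : A
  dense_domain : ∀ q ∈ minimalPrimes A, num ∉ q ∨ den ∉ q

namespace RationalMapToP1

variable {k A : Type*} [Field k] [CommRing A] [Algebra k A]

/-- Two rational maps to `ℙ¹` are equal if they agree at the generic point of every irreducible
component, i.e. if their homogeneous coordinates are proportional there. -/
def Equal (f g : RationalMapToP1 A) : Prop :=
  ∀ q ∈ minimalPrimes A, f.num * g.den - g.num * f.den ∈ q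

/-- The composite `f ∘ Φ` where `Φ : Spec A → Spec A` is the automorphism induced by `τ`. -/
def compAut (f : RationalMapToP1 A) (τ : A ≃ₐ[k] A) : RationalMapToP1 A where
  num := τ f.num
  den := τ f.den
  dense_domain q hq := by
    have h : q.comap (τ : A →+* A) ∈ minimalPrimes A := by
      refine ⟨⟨Ideal.IsPrime.comap _ (hK := hq.1.1), bot_le⟩, ?_⟩
      rintro p ⟨hp, -⟩ hpq x hx
      have hp' : (p.comap (τ.symm : A →+* A)).IsPrime := Ideal.IsPrime.comap _
      have hle : p.comap (τ.symm : A →+* A) ≤ q := fun y hy => by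
        have := hpq hy
        simpa using this
      have := hq.2 ⟨hp', bot_le⟩ hle hx
      simpa using this
    exact f.dense_domain _ h

/-- `f` is non-constant on the component `V(q)`: its restriction `[num : den]` to `V(q)` is not a
constant `[c : d]` with `(c, d) ∈ k² ∖ {0}`. -/
def IsNonconstantOn (k : Type*) [Field k] [Algebra k A] (f : RationalMapToP1 A) (q : Ideal A) :
    Prop :=
  ∀ c d : k, (c ≠ 0 ∨ d ≠ 0) → d • f.num - c • f.den ∉ q

end RationalMapToP1

/-- The automorphism `Φ` of `X = Spec A` induced by `τ` preserves a non-constant fibration: there is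
a rational map `f : X ⇢ ℙ¹` with `f ∘ Φ = f` that is non-constant on (a dense open subset of) some
irreducible component of `X`. -/
def PreservesNonconstantFibration {k A : Type*} [Field k] [CommRing A] [Algebra k A]
    (τ : A ≃ₐ[k] A) : Prop :=
  ∃ f : RationalMapToP1 A, (f.compAut τ).Equal f ∧ ∃ q ∈ minimalPrimes A, f.IsNonconstantOn k q

/-!
Let `A = R / (P ∩ R)`, let `τ` be the automorphism of `A` induced by `σ`, and let `S = R[x^{±1};
σ]`. The ring `S / P` is a quotient of `A[x^{±1}; τ]` in which `A` embeds
(`SkewLaurent.toQuotient`). Primeness of `P` makes the zero ideal of `A` prime relative to `τ`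
(`AutPrime`): `A` is reduced, and `τ` permutes its irreducible components transitively. The proof
depends on the order of `τ`.

If `τ` has finite order, then `S / P` is finite over an affine central subalgebra, generated by
the image of the fixed ring `A^τ` and by the powers `x^{±m}` with `m` the order of `τ`
(`SkewLaurent.exists_finite_over_central`). So rationality and maximality of `P` are both
equivalent to `dim_k S / P < ∞`: from a simple quotient by Nakayama's lemma and the
Nullstellensatz (`finite_of_isSimple`), from an algebraic centre because it is then equal to `k`,
and conversely because a finite-dimensional prime algebra is simple (`one_mem_of_mem_of_ne_zero`).
Condition (ii) fails, since the invariant functions on an infinite-dimensional `A` are not all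
constant (`preservesNonconstantFibration_of_isOfFinOrder`).

If `τ` has infinite order, then every nonzero two-sided ideal of `A[x^{±1}; τ]` contains a nonzero
constant (`SkewLaurent.exists_C_mem_of_ne_zero`). Hence `S / P = A[x^{±1}; τ]` and `P = (P ∩ R)
S`, and `A` is infinite-dimensional, since automorphisms of finite reduced algebras have finite
order. The regular elements of `A[x^{±1}; τ]` form an Ore set, which is shown by counting
dimensions on each irreducible component (`SkewLaurent.exists_nonZeroDivisor_mul_eq_mul`). The
denominators of a central element `z` of the ring of fractions form a nonzero two-sided ideal, so
they include a regular constant `b`. Then `z = t / b` with `t ∈ A`, and `[t : b]` is an invariant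
rational map; conversely an invariant rational map gives a central fraction. So the centre is
algebraic over `k` if and only if no non-constant fibration is preserved. If `S / P` is simple,
then `1` is a denominator, and the centre is `k` by the Nullstellensatz
(`SkewLaurent.isAlgebraic_of_isSimple`).
-/

/-! ### Coefficients of skew Laurent polynomials -/

namespace SkewLaurent

variable {k R : Type*} [CommSemiring k] [CommRing R] [Algebra k R] (σ : R ≃ₐ[k] R)

/-- The additive isomorphism sending `∑ r_n x^n` to the finitely supported function `n ↦ r_n`. -/
noncomputable def coeff : SkewLaurent σ ≃+ (ℤ →₀ R) :=
  (show SkewLaurent σ ≃+ (Multiplicative ℤ →₀ R) from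
    letI := skewAction σ
    (SkewMonoidAlgebra.coeffAddEquiv : SkewMonoidAlgebra R (Multiplicative ℤ) ≃+ _)).trans
      (Finsupp.domCongr Multiplicative.toAdd)

theorem coeff_monomial (n : ℤ) (r : R) : coeff σ (monomial σ n r) = Finsupp.single n r := by
  change Finsupp.domCongr Multiplicative.toAdd (SkewMonoidAlgebra.single _ r).coeff = _
  rw [SkewMonoidAlgebra.coeff_single]
  ext i
  simp [Finsupp.single_apply]

theorem coeff_symm_single (n : ℤ) (r : R) :
    (coeff σ).symm (Finsupp.single n r) = monomial σ n r := by
  rw [AddEquiv.symm_apply_eq, coeff_monomial]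

theorem monomial_add (n : ℤ) (r s : R) :
    monomial σ n (r + s) = monomial σ n r + monomial σ n s := by
  simp [← coeff_symm_single]

variable {σ} in
@[ext]
theorem ext_coeff {f g : SkewLaurent σ} (h : ∀ n, coeff σ f n = coeff σ g n) : f = g :=
  (coeff σ).injective (Finsupp.ext h)

variable {σ} in
theorem induction_monomial {p : SkewLaurent σ → Prop} (f : SkewLaurent σ)
    (hm : ∀ n r, p (monomial σ n r)) (ha : ∀ f g, p f → p g → p (f + g)) : p f := by
  suffices h : ∀ F : ℤ →₀ R, p ((coeff σ).symm F) by
    simpa using h (coeff σ f)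
  intro F
  induction F using Finsupp.induction_linear with
  | zero => simpa [← coeff_symm_single] using hm 0 0
  | add F G hF hG => rw [map_add]; exact ha _ _ hF hG
  | single n r => rw [coeff_symm_single]; exact hm n r

variable {σ} in
theorem sum_monomial (f : SkewLaurent σ) : (coeff σ f).sum (monomial σ) = f := by
  induction f using induction_monomial with
  | hm n r => rw [coeff_monomial, Finsupp.sum_single_index]; simp [← coeff_symm_single]
  | ha f g hf hg =>
    rw [map_add, Finsupp.sum_add_index', hf, hg]
    · intro; simp [← coeff_symm_single]
    · intros; apply monomial_add

theorem coeff_monomial_mul (m t : ℤ) (r : R) (f : SkewLaurent σ) :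
    coeff σ (monomial σ m r * f) t = r * (σ ^ m) (coeff σ f (t - m)) := by
  induction f using induction_monomial with
  | hm n s =>
    rw [monomial_mul_monomial, coeff_monomial, coeff_monomial, Finsupp.single_apply,
      Finsupp.single_apply]
    by_cases h : m + n = t
    · rw [if_pos h, if_pos (by lia)]
    · rw [if_neg h, if_neg (by lia)]; simp
  | ha f g hf hg => simp only [mul_add, map_add, Finsupp.add_apply, hf, hg]

theorem coeff_mul_monomial (m t : ℤ) (r : R) (f : SkewLaurent σ) :
    coeff σ (f * monomial σ m r) t = coeff σ f (t - m) * (σ ^ (t - m)) r := by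
  induction f using induction_monomial with
  | hm n s =>
    rw [monomial_mul_monomial, coeff_monomial, coeff_monomial, Finsupp.single_apply,
      Finsupp.single_apply]
    by_cases h : n + m = t
    · rw [if_pos h, if_pos (by lia)]; subst h; simp
    · rw [if_neg h, if_neg (by lia)]; simp
  | ha f g hf hg => simp only [add_mul, map_add, Finsupp.add_apply, hf, hg]

theorem coeff_mul (f g : SkewLaurent σ) (t : ℤ) :
    coeff σ (f * g) t = (coeff σ f).sum fun i a => a * (σ ^ i) (coeff σ g (t - i)) := by
  induction f using induction_monomial with
  | hm n r => rw [coeff_monomial_mul, coeff_monomial, Finsupp.sum_single_index]; simp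
  | ha f f' hf hf' =>
    rw [add_mul, map_add, Finsupp.add_apply, hf, hf', map_add, Finsupp.sum_add_index']
    · simp
    · intros; ring

theorem C_apply (r : R) : C σ r = monomial σ 0 r := rfl

theorem coeff_C_mul (t : ℤ) (r : R) (f : SkewLaurent σ) :
    coeff σ (C σ r * f) t = r * coeff σ f t := by
  simp [C_apply, coeff_monomial_mul]

theorem coeff_mul_C (t : ℤ) (r : R) (f : SkewLaurent σ) :
    coeff σ (f * C σ r) t = coeff σ f t * (σ ^ t) r := by
  simp [C_apply, coeff_mul_monomial]

theorem coeff_C (r : R) : coeff σ (C σ r) = Finsupp.single 0 r := coeff_monomial σ 0 r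

theorem coeff_one : coeff σ 1 = Finsupp.single 0 1 := coeff_monomial σ 0 1

theorem C_injective : Function.Injective (C σ) := fun r s h => by
  simpa [coeff_C] using congrArg (fun f => coeff σ f 0) h

theorem algebraMap_eq (c : k) : algebraMap k (SkewLaurent σ) c = C σ (algebraMap k R c) := rfl

theorem monomial_eq_C_mul (n : ℤ) (r : R) : monomial σ n r = C σ r * monomial σ n 1 := by
  simp [C_apply, monomial_mul_monomial]

/-- The variable `x`, as a unit. -/
noncomputable def X : (SkewLaurent σ)ˣ where
  val := monomial σ 1 1
  inv := monomial σ (-1) 1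
  val_inv := by rw [monomial_mul_monomial]; simp; rfl
  inv_val := by rw [monomial_mul_monomial]; simp; rfl

theorem X_zpow (n : ℤ) : ((X σ ^ n : (SkewLaurent σ)ˣ) : SkewLaurent σ) = monomial σ n 1 := by
  induction n with
  | zero => rfl
  | succ n ih =>
    rw [zpow_add, zpow_one, Units.val_mul, ih]
    change _ * monomial σ 1 1 = _
    simp [monomial_mul_monomial]
  | pred n ih =>
    rw [sub_eq_add_neg, zpow_add, zpow_neg_one, Units.val_mul, ih]
    change _ * monomial σ (-1) 1 = _
    simp [monomial_mul_monomial]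

theorem X_mul_C (r : R) : (X σ : SkewLaurent σ) * C σ r = C σ (σ r) * X σ := by
  change monomial σ 1 1 * monomial σ 0 r = monomial σ 0 (σ r) * monomial σ 1 1
  simp [monomial_mul_monomial]

section Lift

variable {σ} {T : Type*} [Ring T] [Algebra k T] (j : R →ₐ[k] T) (u : Tˣ)

theorem units_zpow_mul_of_mul (h : ∀ r, (u : T) * j r = j (σ r) * u) (n : ℤ) (r : R) :
    ((u ^ n : Tˣ) : T) * j r = j ((σ ^ n) r) * ((u ^ n : Tˣ) : T) := by
  have h' : ∀ r, ((u⁻¹ : Tˣ) : T) * j r = j (σ⁻¹ r) * ((u⁻¹ : Tˣ) : T) := fun r => by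
    rw [Units.inv_mul_eq_iff_eq_mul, ← mul_assoc, h, Units.eq_mul_inv_iff_mul_eq]
    have : σ (σ⁻¹ r) = r := σ.apply_symm_apply r
    rw [this]
  induction n generalizing r with
  | zero => simp
  | succ n ih =>
    rw [zpow_add, zpow_one, Units.val_mul, mul_assoc, h, ← mul_assoc, ih, zpow_add, zpow_one,
      mul_assoc]
    rfl
  | pred n ih =>
    rw [sub_eq_add_neg, zpow_add, zpow_neg_one, Units.val_mul, mul_assoc, h', ← mul_assoc, ih,
      zpow_add, zpow_neg_one, mul_assoc]
    rfl

/-- The universal property of the skew Laurent polynomial ring: a `k`-algebra map `j : R → T` and a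
unit `u` of `T` with `u * j r = j (σ r) * u` give a map sending `r` to `j r` and `x` to `u`. -/
noncomputable def lift (h : ∀ r, (u : T) * j r = j (σ r) * u) : SkewLaurent σ →ₐ[k] T :=
  let L : (ℤ →₀ R) →+ T := Finsupp.liftAddHom fun n =>
    (AddMonoidHom.mulRight ((u ^ n : Tˣ) : T)).comp j.toAddMonoidHom
  let φ : SkewLaurent σ →+ T := L.comp (coeff σ).toAddMonoidHom
  have hφ : ∀ n r, φ (monomial σ n r) = j r * ((u ^ n : Tˣ) : T) := fun n r => by
    change L (coeff σ _) = _
    rw [coeff_monomial]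
    simp [L]
  { φ with
    map_one' := (hφ 0 1).trans (by simp)
    map_zero' := map_zero φ
    map_mul' := fun f g => by
      change φ (f * g) = φ f * φ g
      induction f using induction_monomial with
      | ha f f' hf hf' => rw [add_mul, map_add, hf, hf', map_add, add_mul]
      | hm m r =>
        induction g using induction_monomial with
        | ha g g' hg hg' => rw [mul_add, map_add, hg, hg', map_add, mul_add]
        | hm n s =>
          rw [monomial_mul_monomial, hφ, hφ, hφ, mul_assoc, ← mul_assoc _ (j s),
            units_zpow_mul_of_mul j u h, map_mul, zpow_add, Units.val_mul]
          simp only [mul_assoc]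
    commutes' := fun c => (hφ 0 (algebraMap k R c)).trans (by simp) }

theorem lift_monomial (h : ∀ r, (u : T) * j r = j (σ r) * u) (n : ℤ) (r : R) :
    lift j u h (monomial σ n r) = j r * ((u ^ n : Tˣ) : T) := by
  change Finsupp.liftAddHom _ (coeff σ _) = _
  rw [coeff_monomial]
  simp

theorem lift_C (h : ∀ r, (u : T) * j r = j (σ r) * u) (r : R) : lift j u h (C σ r) = j r := by
  simp [C_apply, lift_monomial]

end Lift

end SkewLaurent

/-! ### Minimal primes and automorphisms -/

section MinimalPrimes

variable {A : Type*} [CommRing A]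

theorem eq_zero_of_mem_minimalPrimes [IsReduced A] {a : A} (h : ∀ q ∈ minimalPrimes A, a ∈ q) :
    a = 0 := by
  have h1 : a ∈ sInf (minimalPrimes A) := Ideal.mem_sInf.2 fun {q} hq => h q hq
  have h2 : sInf (minimalPrimes A) = nilradical A := Ideal.sInf_minimalPrimes
  rw [h2, mem_nilradical] at h1
  exact h1.eq_zero

theorem exists_notMem_minimalPrime [IsNoetherianRing A] {q : Ideal A} (hq : q ∈ minimalPrimes A) :
    ∃ c, c ∉ q ∧ ∀ q' ∈ minimalPrimes A, q' ≠ q → c ∈ q' := by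
  classical
  have hfin := minimalPrimes.finite_of_isNoetherianRing A
  have hqp : q.IsPrime := hq.1.1
  set s := hfin.toFinset.erase q
  have h : ¬ s.inf id ≤ q := by
    rw [Ideal.IsPrime.inf_le' hqp]
    rintro ⟨p, hp, hpq⟩
    simp only [s, Finset.mem_erase, Set.Finite.mem_toFinset] at hp
    exact hp.1 (le_antisymm hpq (hq.2 hp.2.1 hpq))
  obtain ⟨c, hc, hcq⟩ := SetLike.not_le_iff_exists.1 h
  refine ⟨c, hcq, fun q' hq' hne => ?_⟩
  rw [Submodule.mem_finsetInf] at hc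
  exact hc q' (by simp [s, hq', hne])

variable {k : Type*} [CommSemiring k] [Algebra k A]

theorem comap_mem_minimalPrimes (τ : A ≃ₐ[k] A) {q : Ideal A} (hq : q ∈ minimalPrimes A) :
    q.comap (τ : A →+* A) ∈ minimalPrimes A := by
  have := hq.1.1
  refine ⟨⟨Ideal.IsPrime.comap _, bot_le⟩, ?_⟩
  rintro p ⟨hp, -⟩ hpq x hx
  have hle : p.comap (τ.symm : A →+* A) ≤ q := fun y hy => by
    have := hpq hy
    simpa using this
  have := hq.2 ⟨Ideal.IsPrime.comap _, bot_le⟩ hle hx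
  simpa using this

theorem zpow_apply_zpow_apply (τ : A ≃ₐ[k] A) (i j : ℤ) (a : A) :
    (τ ^ i) ((τ ^ j) a) = (τ ^ (i + j)) a := by
  rw [zpow_add]; rfl

theorem apply_zpow_apply (τ : A ≃ₐ[k] A) (i : ℤ) (a : A) :
    (τ ^ i) (τ a) = (τ ^ (i + 1)) a := by
  rw [zpow_add, zpow_one]; rfl

/-- An automorphism permutes the finitely many minimal primes, so some power of it stabilizes each
of them. -/
theorem exists_pow_stabilizes_minimalPrimes [IsNoetherianRing A] (τ : A ≃ₐ[k] A) :
    ∃ n : ℕ, 0 < n ∧ ∀ i : ℤ, (n : ℤ) ∣ i → ∀ q ∈ minimalPrimes A, ∀ a,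
      (τ ^ i) a ∈ q ↔ a ∈ q := by
  have hfin := minimalPrimes.finite_of_isNoetherianRing A
  have : Finite (minimalPrimes A) := hfin
  let π : Equiv.Perm (minimalPrimes A) :=
    { toFun := fun q => ⟨_, comap_mem_minimalPrimes τ q.2⟩
      invFun := fun q => ⟨_, comap_mem_minimalPrimes τ.symm q.2⟩
      left_inv := fun q => by ext a; simp
      right_inv := fun q => by ext a; simp }
  have hπ : ∀ (n : ℕ) (q : minimalPrimes A) (a : A),
      a ∈ ((π ^ n) q : minimalPrimes A).1 ↔ (τ ^ n) a ∈ q.1 := by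
    intro n
    induction n with
    | zero => simp
    | succ n ih =>
      intro q a
      rw [pow_succ', pow_succ]
      change τ a ∈ ((π ^ n) q : minimalPrimes A).1 ↔ _
      rw [ih]
      rfl
  obtain ⟨n, hn, hn1⟩ := (isOfFinOrder_of_finite π).exists_pow_eq_one
  have hnat : ∀ (m : ℕ), ∀ q ∈ minimalPrimes A, ∀ a, (τ ^ (n * m)) a ∈ q ↔ a ∈ q :=
    fun m q hq a => by
      rw [← hπ (n * m) ⟨q, hq⟩ a, pow_mul, hn1, one_pow]
      rfl
  refine ⟨n, hn, ?_⟩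
  rintro i ⟨m, rfl⟩ q hq a
  obtain ⟨m, rfl | rfl⟩ := m.eq_nat_or_neg
  · exact_mod_cast hnat m q hq a
  · rw [← hnat m q hq ((τ ^ ((n : ℤ) * (-(m : ℤ)))) a)]
    have : τ ^ (n * m) = τ ^ ((n : ℤ) * m) := by exact_mod_cast rfl
    rw [this, zpow_apply_zpow_apply]
    simp

end MinimalPrimes

/-! ### Rings whose zero ideal is prime relative to an automorphism -/

/-- The zero ideal of `A` is `τ`-prime: if all products `a * τ^i b` vanish, then `a = 0` or
`b = 0`. -/
def AutPrime {k A : Type*} [CommSemiring k] [CommRing A] [Algebra k A] (τ : A ≃ₐ[k] A) : Prop :=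
  ∀ a b : A, (∀ i : ℤ, a * (τ ^ i) b = 0) → a = 0 ∨ b = 0

namespace AutPrime

variable {k A : Type*} [CommSemiring k] [CommRing A] [Algebra k A] {τ : A ≃ₐ[k] A}

/-- The nilradical is nilpotent and stable under `τ`, so it vanishes. -/
theorem isReduced [IsNoetherianRing A] (h : AutPrime τ) : IsReduced A := by
  rw [← nilradical_eq_bot_iff]
  obtain ⟨n, hn⟩ := IsNoetherianRing.isNilpotent_nilradical A
  by_contra hne
  obtain ⟨b, hb, hb0⟩ := Submodule.exists_mem_ne_zero_of_ne_bot hne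
  have : ∀ m, nilradical A ^ m = ⊥ → False := by
    intro m
    induction m with
    | zero =>
      intro h0
      rw [pow_zero, Ideal.one_eq_top] at h0
      exact hne (le_bot_iff.1 (h0 ▸ le_top))
    | succ m ih =>
      intro hm
      refine ih (le_bot_iff.1 fun c hc => ?_)
      refine (h c b fun i => ?_).resolve_right hb0
      rw [← Ideal.mem_bot, ← hm, pow_succ]
      refine Ideal.mul_mem_mul hc ?_
      rw [mem_nilradical] at hb ⊢
      exact hb.map _
  exact this n hn

/-- A form of the transitivity of `τ` on the irreducible components: if the whole orbit of `f`
vanishes on one component, then `f = 0`, because an element that vanishes on all other components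
annihilates this orbit. -/
theorem eq_zero_of_forall_mem [IsNoetherianRing A] (h : AutPrime τ) {q : Ideal A}
    (hq : q ∈ minimalPrimes A) {f : A} (hf : ∀ i : ℤ, (τ ^ i) f ∈ q) : f = 0 := by
  have := h.isReduced
  obtain ⟨c, hc, hc'⟩ := exists_notMem_minimalPrime hq
  refine (h c f fun i => eq_zero_of_mem_minimalPrimes fun q' hq' => ?_).resolve_left ?_
  · by_cases hqq : q' = q
    · exact hqq ▸ Ideal.mul_mem_left _ _ (hf i)
    · exact Ideal.mul_mem_right _ _ (hc' q' hq' hqq)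
  · rintro rfl
    exact hc q.zero_mem

/-- If the components on which `f` vanishes form a `τ`-stable nonempty set, then `f = 0`. -/
theorem eq_zero_of_mem_of_apply_mem [IsNoetherianRing A] (h : AutPrime τ) {q : Ideal A}
    (hq : q ∈ minimalPrimes A) {f : A} (hf : f ∈ q) (h1 : ∀ q ∈ minimalPrimes A, f ∈ q → τ f ∈ q)
    (h2 : ∀ q ∈ minimalPrimes A, τ f ∈ q → f ∈ q) : f = 0 := by
  have key : ∀ i : ℤ, ∀ q ∈ minimalPrimes A, ((τ ^ i) f ∈ q ↔ (τ ^ (i + 1)) f ∈ q) := by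
    intro i q hq
    rw [← apply_zpow_apply]
    have hq' := comap_mem_minimalPrimes (τ ^ i) hq
    exact ⟨fun hx => h1 _ hq' hx, fun hx => h2 _ hq' hx⟩
  refine h.eq_zero_of_forall_mem hq fun i => ?_
  induction i with
  | zero => simpa using hf
  | succ n ih => exact (key _ _ hq).1 ih
  | pred n ih => exact (key _ _ hq).2 (by simpa using ih)

/-- The differences `τ^i r - r` form a `τ`-stable set, so they have no common nonzero annihilator
unless they all vanish. -/
theorem eq_zero_of_mul_sub (h : AutPrime τ) {i : ℤ} (hi : τ ^ i ≠ 1) {c : A}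
    (hc : ∀ r, c * ((τ ^ i) r - r) = 0) : c = 0 := by
  by_contra hc0
  refine hi (AlgEquiv.ext fun r => sub_eq_zero.1 ((h c _ fun l => ?_).resolve_left hc0))
  rw [map_sub, zpow_apply_zpow_apply, add_comm, ← zpow_apply_zpow_apply]
  exact hc _

end AutPrime

/-! ### The Nullstellensatz -/

theorem exists_sub_algebraMap_mem_of_isMaximal {k B : Type*} [Field k] [IsAlgClosed k]
    [CommRing B] [Algebra k B] [Algebra.FiniteType k B] (m : Ideal B) [m.IsMaximal] (b : B) :
    ∃ c : k, b - algebraMap k B c ∈ m := by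
  let := Ideal.Quotient.field m
  have : Module.Finite k (B ⧸ m) := finite_of_finite_type_of_isJacobsonRing k (B ⧸ m)
  obtain ⟨c, hc⟩ := (IsAlgClosed.algebraMap_bijective_of_isIntegral (k := k) (K := B ⧸ m)).2
    (Ideal.Quotient.mk m b)
  refine ⟨c, Ideal.Quotient.eq.1 ?_⟩
  rw [← hc]
  rfl

/-! ### The Ore condition -/

namespace SkewLaurent

open scoped nonZeroDivisors

variable {k A : Type*} [CommSemiring k] [CommRing A] [Algebra k A] (τ : A ≃ₐ[k] A)

theorem exists_least_notMem (f : ℤ →₀ A) {q : Ideal A} (h : ∃ i, f i ∉ q) :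
    ∃ m, f m ∉ q ∧ ∀ i < m, f i ∈ q := by
  classical
  have hne : (f.support.filter fun i => f i ∉ q).Nonempty := by
    obtain ⟨i, hi⟩ := h
    refine ⟨i, Finset.mem_filter.2 ⟨Finsupp.mem_support_iff.2 fun h0 => hi ?_, hi⟩⟩
    rw [h0]
    exact q.zero_mem
  refine ⟨_, (Finset.mem_filter.1 (Finset.min'_mem _ hne)).2, fun i hi => ?_⟩
  by_contra hiq
  have hi0 : f i ≠ 0 := fun h0 => hiq (h0 ▸ q.zero_mem)
  have hmem : i ∈ f.support.filter fun i => f i ∉ q :=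
    Finset.mem_filter.2 ⟨Finsupp.mem_support_iff.2 hi0, hiq⟩
  exact not_le_of_gt hi (Finset.min'_le _ _ hmem)

theorem mem_of_sum_mem {f : ℤ →₀ A} {q : Ideal A} {F : ℤ → A → A} (h : f.sum F ∈ q)
    (h0 : ∀ i, F i 0 = 0) (m : ℤ) (hF : ∀ i ≠ m, F i (f i) ∈ q) : F m (f m) ∈ q := by
  classical
  by_cases hm : m ∈ f.support
  · rw [Finsupp.sum, ← Finset.add_sum_erase _ _ hm] at h
    exact (Ideal.add_mem_iff_left q (Ideal.sum_mem q fun i hi =>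
      hF i (Finset.ne_of_mem_erase hi))).1 h
  · rw [Finsupp.notMem_support_iff.1 hm, h0]
    exact q.zero_mem

/-- A criterion for regularity. If `τ^n` stabilizes every minimal prime, then an element whose
exponents are multiples of `n` and which does not vanish on any irreducible component is regular:
the product of the lowest terms on a component does not vanish. -/
theorem mem_nonZeroDivisors_of_forall_exists_notMem [IsReduced A] {n : ℕ}
    (hn : ∀ i : ℤ, (n : ℤ) ∣ i → ∀ q ∈ minimalPrimes A, ∀ a, (τ ^ i) a ∈ q ↔ a ∈ q)
    {s : SkewLaurent τ} (h1 : ∀ i, ¬ (n : ℤ) ∣ i → coeff τ s i = 0)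
    (h2 : ∀ q ∈ minimalPrimes A, ∃ i, coeff τ s i ∉ q) : s ∈ (SkewLaurent τ)⁰ := by
  have hdvd : ∀ {q : Ideal A} {i}, coeff τ s i ∉ q → (n : ℤ) ∣ i := fun {q i} hi => by
    by_contra h
    rw [h1 i h] at hi
    exact hi q.zero_mem
  refine ⟨fun g hg => ?_, fun g hg => ?_⟩
  · ext l
    refine eq_zero_of_mem_minimalPrimes fun q hq => ?_
    have hqp : q.IsPrime := hq.1.1
    by_contra hl
    obtain ⟨l, hl, hl'⟩ := exists_least_notMem (coeff τ g) ⟨_, hl⟩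
    obtain ⟨m, hm, hm'⟩ := exists_least_notMem (coeff τ s) (h2 q hq)
    have h0 : coeff τ (s * g) (m + l) ∈ q := by rw [hg]; exact q.zero_mem
    rw [coeff_mul] at h0
    have := mem_of_sum_mem h0 (by simp) m fun i hi => ?_
    · rw [add_sub_cancel_left] at this
      rcases hqp.mem_or_mem this with h | h
      · exact hm h
      · exact hl ((hn m (hdvd hm) q hq _).1 h)
    · rcases lt_or_gt_of_ne hi with h | h
      · exact Ideal.mul_mem_right _ _ (hm' i h)
      · by_cases hni : (n : ℤ) ∣ i
        · exact Ideal.mul_mem_left _ _ ((hn i hni q hq _).2 (hl' _ (by lia)))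
        · rw [h1 i hni, zero_mul]
          exact q.zero_mem
  · ext l
    refine eq_zero_of_mem_minimalPrimes fun j hj => ?_
    have hjp : j.IsPrime := hj.1.1
    by_contra hl
    obtain ⟨l, hl, hl'⟩ := exists_least_notMem (coeff τ g) ⟨_, hl⟩
    have hq := comap_mem_minimalPrimes (τ ^ l) hj
    obtain ⟨m, hm, hm'⟩ := exists_least_notMem (coeff τ s) (h2 _ hq)
    have h0 : coeff τ (g * s) (m + l) ∈ j := by rw [hg]; exact j.zero_mem
    rw [coeff_mul] at h0
    -- Modulo `j`, only the product of the lowest terms survives: the factor of a term with `i > l`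
    -- coming from `s` is `τ^i` of a coefficient in `τ^(-l) j`, and `i ≡ l` modulo `n`.
    have := mem_of_sum_mem h0 (by simp) l fun i hi => ?_
    · rw [add_sub_cancel_right] at this
      rcases hjp.mem_or_mem this with h | h
      · exact hl h
      · exact hm h
    · rcases lt_or_gt_of_ne hi with h | h
      · exact Ideal.mul_mem_right _ _ (hl' i h)
      · by_cases hni : (n : ℤ) ∣ m + l - i
        · refine Ideal.mul_mem_left _ _ ?_
          have h3 : (n : ℤ) ∣ i - l := by
            have := dvd_sub (hdvd hm) hni
            rwa [show m - (m + l - i) = i - l by ring] at this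
          have h4 := hm' (m + l - i) (by lia)
          have h5 := (hn (i - l) h3 _ hj ((τ ^ l) (coeff τ s (m + l - i)))).2 h4
          rwa [zpow_apply_zpow_apply, sub_add_cancel] at h5
        · rw [h1 _ hni, map_zero, mul_zero]
          exact j.zero_mem

theorem C_mem_nonZeroDivisors [IsReduced A] {b : A} (hb : ∀ q ∈ minimalPrimes A, b ∉ q) :
    C τ b ∈ (SkewLaurent τ)⁰ := by
  refine mem_nonZeroDivisors_of_forall_exists_notMem τ (n := 0) ?_ ?_ fun q hq => ⟨0, ?_⟩
  · intro i hi
    rw [Nat.cast_zero, zero_dvd_iff] at hi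
    simp [hi]
  · intro i hi
    rw [Nat.cast_zero, zero_dvd_iff] at hi
    rw [coeff_C, Finsupp.single_apply, if_neg (Ne.symm hi)]
  · simpa [coeff_C] using hb q hq

theorem coeff_sum_monomial_apply {ι : Type*} (t : Finset ι) (e : ι → ℤ) (a : ι → A)
    (f : ι → SkewLaurent τ) (m : ℤ) :
    coeff τ (∑ i ∈ t, monomial τ (e i) (a i) * f i) m =
      ∑ i ∈ t, a i * (τ ^ e i) (coeff τ (f i) (m - e i)) := by
  simp [Finsupp.finsetSum_apply, coeff_monomial_mul]

theorem exists_coeff_bound (r s : SkewLaurent τ) :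
    ∃ c : ℕ, ∀ i : ℤ, (c : ℤ) < |i| → coeff τ r i = 0 ∧ coeff τ s i = 0 := by
  classical
  refine ⟨((coeff τ r).support ∪ (coeff τ s).support).sup Int.natAbs, fun i hi => ?_⟩
  have : i ∉ (coeff τ r).support ∪ (coeff τ s).support := fun h => by
    have := Finset.le_sup (f := Int.natAbs) h
    rw [Int.abs_eq_natAbs] at hi
    lia
  rw [Finset.notMem_union, Finsupp.notMem_support_iff, Finsupp.notMem_support_iff] at this
  exact this

/-- The Ore condition on one irreducible component `V(q)`. Over the domain `A/q`, the elements
`x^(n*l) * r` with `0 ≤ l ≤ 2c` and `x^l * s` with `0 ≤ l ≤ 2cn` number one more than the degrees in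
which they live, so they satisfy a linear relation. Multiplying it by an element
that vanishes on all other components gives a relation over `A`. -/
theorem exists_mul_eq_mul_on_component [IsReduced A] [IsNoetherianRing A] {n : ℕ} (hn : 0 < n)
    (r s : SkewLaurent τ) (hs : ∀ g, g * s = 0 → g = 0) {q : Ideal A} (hq : q ∈ minimalPrimes A) :
    ∃ d g : SkewLaurent τ, d * r = g * s ∧ (∀ i, ¬ (n : ℤ) ∣ i → coeff τ d i = 0) ∧
      (∀ q' ∈ minimalPrimes A, q' ≠ q → ∀ i, coeff τ d i ∈ q') ∧ ∃ i, coeff τ d i ∉ q := by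
  have hqp : q.IsPrime := hq.1.1
  obtain ⟨c, hc⟩ := exists_coeff_bound τ r s
  obtain ⟨a, haq, ha⟩ := exists_notMem_minimalPrime hq
  have ha0 : ∀ y ∈ q, a * y = 0 := fun y hy => eq_zero_of_mem_minimalPrimes fun q' hq' => by
    by_cases h : q' = q
    · exact h ▸ Ideal.mul_mem_left _ _ hy
    · exact Ideal.mul_mem_right _ _ (ha q' hq' h)
  obtain ⟨N, hN⟩ : ∃ N : ℕ, N = n * (2 * c) := ⟨_, rfl⟩
  -- The relation sought has the coefficients `d` at `x^(n*l) * r` and `g` at `x^l * s`.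
  let e : Fin (2 * c + 1) ⊕ Fin (N + 1) → ℤ := Sum.elim (fun l => (n : ℤ) * l) (fun l => l)
  let b : Fin (2 * c + 1) ⊕ Fin (N + 1) → SkewLaurent τ := Sum.elim (fun _ => r) (fun _ => s)
  have he : ∀ i, 0 ≤ e i ∧ e i ≤ N := by
    rintro (l | l)
    · change 0 ≤ (n : ℤ) * ((l : ℕ) : ℤ) ∧ (n : ℤ) * ((l : ℕ) : ℤ) ≤ N
      refine ⟨by positivity, ?_⟩
      have : (l : ℕ) ≤ 2 * c := by lia
      rw [hN]
      exact_mod_cast Nat.mul_le_mul_left n this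
    · change 0 ≤ ((l : ℕ) : ℤ) ∧ ((l : ℕ) : ℤ) ≤ N
      have := l.isLt
      lia
  have hb : ∀ i (m : ℤ), (c : ℤ) < |m| → coeff τ (b i) m = 0 := by
    rintro (l | l) m hm
    · exact (hc m hm).1
    · exact (hc m hm).2
  let v : Fin (2 * c + 1) ⊕ Fin (N + 1) → Fin (N + 2 * c + 1) → A ⧸ q := fun i t =>
    Ideal.Quotient.mk q ((τ ^ e i) (coeff τ (b i) ((t : ℕ) - c - e i)))
  -- All degrees involved lie in `[-c, N + c]`, and there are `N + 2c + 2` vectors.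
  have hv : ¬ LinearIndependent (A ⧸ q) v := fun h => by
    have := h.fintype_card_le_finrank
    simp only [Fintype.card_sum, Fintype.card_fin, Module.finrank_fin_fun] at this
    lia
  rw [Fintype.not_linearIndependent_iff] at hv
  obtain ⟨y, hy, i₀, hi₀⟩ := hv
  choose z hz using fun i => Ideal.Quotient.mk_surjective (y i)
  have hi₀ : z i₀ ∉ q := fun h => hi₀ (by rw [← hz]; exact Ideal.Quotient.eq_zero_iff_mem.2 h)
  have hrel : ∑ i, monomial τ (e i) (a * z i) * b i = 0 := by
    ext m
    rw [coeff_sum_monomial_apply]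
    simp only [mul_assoc]
    rw [← Finset.mul_sum]
    simp only [map_zero, Finsupp.zero_apply]
    by_cases hm : 0 ≤ m + c ∧ m ≤ N + c
    · refine ha0 _ (Ideal.Quotient.eq_zero_iff_mem.1 ?_)
      have h1 := congrFun hy ⟨(m + c).toNat, by lia⟩
      rw [Finset.sum_apply, Pi.zero_apply] at h1
      rw [map_sum, ← h1]
      refine Finset.sum_congr rfl fun i _ => ?_
      rw [map_mul, hz, Pi.smul_apply, smul_eq_mul]
      simp only [v]
      rw [show (((m + c).toNat : ℕ) : ℤ) - c - e i = m - e i by lia]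
    · rw [Finset.sum_eq_zero, mul_zero]
      intro i _
      rw [hb i, map_zero, mul_zero]
      have := he i
      rw [lt_abs]
      lia
  rw [Fintype.sum_sum_type] at hrel
  simp only [b, Sum.elim_inl, Sum.elim_inr] at hrel
  rw [← Finset.sum_mul, ← Finset.sum_mul] at hrel
  set d := ∑ l, monomial τ (e (Sum.inl l)) (a * z (Sum.inl l))
  set g := ∑ l, monomial τ (e (Sum.inr l)) (a * z (Sum.inr l))
  have hdc : ∀ i, coeff τ d i = ∑ l, if e (Sum.inl l) = i then a * z (Sum.inl l) else 0 := by
    intro i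
    simp only [d, map_sum, Finsupp.finsetSum_apply, coeff_monomial, Finsupp.single_apply]
  have hgc : ∀ i, coeff τ g i = ∑ l, if e (Sum.inr l) = i then a * z (Sum.inr l) else 0 := by
    intro i
    simp only [g, map_sum, Finsupp.finsetSum_apply, coeff_monomial, Finsupp.single_apply]
  have hdl : ∀ l, coeff τ d (e (Sum.inl l)) = a * z (Sum.inl l) := fun l => by
    rw [hdc, Finset.sum_eq_single l, if_pos rfl]
    · intro l' _ hne
      rw [if_neg]
      intro h
      have h' := mul_left_cancel₀ (by exact_mod_cast hn.ne') h
      exact hne (Fin.ext (by exact_mod_cast h'))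
    · simp
  have hgl : ∀ l, coeff τ g (e (Sum.inr l)) = a * z (Sum.inr l) := fun l => by
    rw [hgc, Finset.sum_eq_single l, if_pos rfl]
    · intro l' _ hne
      rw [if_neg]
      exact fun h => hne (Fin.ext (Nat.cast_injective h))
    · simp
  refine ⟨d, -g, by rw [neg_mul]; exact eq_neg_of_add_eq_zero_left hrel, ?_, ?_, ?_⟩
  · intro i hi
    rw [hdc]
    refine Finset.sum_eq_zero fun l _ => if_neg fun h => hi ?_
    rw [← h]
    exact dvd_mul_right _ _
  · intro q' hq' hne i
    rw [hdc]
    refine Ideal.sum_mem _ fun l _ => ?_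
    split_ifs
    · exact Ideal.mul_mem_right _ _ (ha q' hq' hne)
    · exact q'.zero_mem
  · -- If `d` vanished on `V(q)`, then `d = 0` and `g * s = 0`, so the relation would be trivial.
    by_contra! hall
    have hzl : ∀ l, z (Sum.inl l) ∈ q := fun l =>
      (hqp.mem_or_mem ((hdl l) ▸ hall (e (Sum.inl l)))).resolve_left haq
    have hd0 : d = 0 := Finset.sum_eq_zero fun l _ => by
      rw [ha0 _ (hzl l), ← coeff_symm_single]
      simp
    rw [hd0, zero_mul, zero_add] at hrel
    have hg0 := hs g hrel
    have hzr : ∀ l, z (Sum.inr l) ∈ q := fun l => by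
      have := hgl l
      rw [hg0, map_zero, Finsupp.zero_apply] at this
      exact (hqp.mem_or_mem (this ▸ q.zero_mem : a * z (Sum.inr l) ∈ q)).resolve_left haq
    rcases i₀ with l | l
    · exact hi₀ (hzl l)
    · exact hi₀ (hzr l)

/-- The left Ore condition for `A[x^{±1}; τ]` over a reduced Noetherian ring `A`: the sum of the
multipliers found on the irreducible components is regular. -/
theorem exists_nonZeroDivisor_mul_eq_mul [IsReduced A] [IsNoetherianRing A] (r s : SkewLaurent τ)
    (hs : s ∈ (SkewLaurent τ)⁰) : ∃ s' ∈ (SkewLaurent τ)⁰, ∃ r', s' * r = r' * s := by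
  classical
  obtain ⟨n, hn, hnq⟩ := exists_pow_stabilizes_minimalPrimes τ
  have hfin := minimalPrimes.finite_of_isNoetherianRing A
  have := hfin.fintype
  choose d g h1 h2 h3 h4 using fun q : minimalPrimes A =>
    exists_mul_eq_mul_on_component τ hn r s hs.2 q.2
  refine ⟨∑ q, d q, mem_nonZeroDivisors_of_forall_exists_notMem τ hnq ?_ ?_, ∑ q, g q, ?_⟩
  · intro i hi
    simp [Finsupp.finsetSum_apply, h2 _ i hi]
  · intro q hq
    obtain ⟨i, hi⟩ := h4 ⟨q, hq⟩
    refine ⟨i, fun h => hi ?_⟩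
    rw [map_sum, Finsupp.finsetSum_apply, ← Finset.add_sum_erase _ _ (Finset.mem_univ ⟨q, hq⟩)]
      at h
    refine (Ideal.add_mem_iff_left q (Ideal.sum_mem q fun q' hq' => ?_)).1 h
    exact h3 q' q hq (fun h => Finset.ne_of_mem_erase hq' (Subtype.ext h.symm)) i
  · simp only [Finset.sum_mul, h1]

end SkewLaurent

/-! ### Automorphisms of infinite order -/

namespace SkewLaurent

open scoped nonZeroDivisors

section Ideals

variable {k A : Type*} [CommSemiring k] [CommRing A] [Algebra k A] {τ : A ≃ₐ[k] A}

/-- If `τ` has infinite order, then the centralizer of the constants consists of constants. -/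
theorem eq_C_of_commute (hτ : AutPrime τ) (hinf : ∀ i : ℤ, i ≠ 0 → τ ^ i ≠ 1) {s : SkewLaurent τ}
    (h : ∀ r, C τ r * s = s * C τ r) : s = C τ (coeff τ s 0) := by
  ext i
  rw [coeff_C, Finsupp.single_apply]
  split_ifs with hi
  · rw [hi]
  · refine hτ.eq_zero_of_mul_sub (hinf i (Ne.symm hi)) fun r => ?_
    have := congrArg (fun f => coeff τ f i) (h r)
    simp only [coeff_C_mul, coeff_mul_C] at this
    rw [mul_sub, ← this, mul_comm, sub_self]

/-- A nonzero two-sided ideal contains a nonzero constant: commuting a nonzero element with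
constants, twisted so as to cancel one of its terms, shortens it unless it is a monomial. -/
theorem exists_C_mem_of_ne_zero (hτ : AutPrime τ) (hinf : ∀ i : ℤ, i ≠ 0 → τ ^ i ≠ 1)
    (J : TwoSidedIdeal (SkewLaurent τ)) {s : SkewLaurent τ} (hs : s ∈ J) (hs0 : s ≠ 0) :
    ∃ a, a ≠ 0 ∧ C τ a ∈ J := by
  classical
  induction hn : (coeff τ s).support.card using Nat.strong_induction_on generalizing s with
  | _ n ih =>
  subst hn
  obtain ⟨l, hl⟩ : ∃ l, coeff τ s l ≠ 0 := by
    by_contra! h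
    exact hs0 (ext_coeff (by simpa using h))
  have hco : ∀ r i, coeff τ (s * C τ r - C τ ((τ ^ l) r) * s) i =
      coeff τ s i * ((τ ^ i) r - (τ ^ l) r) := fun r i => by
    rw [map_sub, Finsupp.sub_apply, coeff_mul_C, coeff_C_mul]
    ring
  by_cases h : ∀ r, s * C τ r - C τ ((τ ^ l) r) * s = 0
  · have hm : s = monomial τ l (coeff τ s l) := by
      ext i
      rw [coeff_monomial, Finsupp.single_apply]
      split_ifs with hi
      · rw [hi]
      · refine hτ.eq_zero_of_mul_sub (hinf (i - l) (sub_ne_zero.2 (Ne.symm hi))) fun r => ?_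
        have := hco ((τ ^ (-l)) r) i
        rw [h, map_zero, Finsupp.zero_apply, zpow_apply_zpow_apply, zpow_apply_zpow_apply,
          add_neg_cancel, zpow_zero, ← sub_eq_add_neg] at this
        exact this.symm
    refine ⟨_, hl, ?_⟩
    have := J.mul_mem_right _ (monomial τ (-l) 1) hs
    rw [hm, monomial_mul_monomial] at this
    simpa [C_apply] using this
  · push Not at h
    obtain ⟨r, hr⟩ := h
    refine ih _ ?_ (J.sub_mem (J.mul_mem_right _ _ hs) (J.mul_mem_left _ _ hs)) hr rfl
    refine Finset.card_lt_card ((Finset.ssubset_iff_of_subset fun i hi => ?_).2 ⟨l, ?_, ?_⟩)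
    · rw [Finsupp.mem_support_iff, hco] at hi
      exact Finsupp.mem_support_iff.2 (left_ne_zero_of_mul hi)
    · exact Finsupp.mem_support_iff.2 hl
    · rw [Finsupp.notMem_support_iff, hco, sub_self, mul_zero]

/-- A nonzero two-sided ideal contains a regular constant: by prime avoidance, since its constants
form a nonzero `τ`-stable ideal, which lies in no minimal prime. -/
theorem exists_C_mem_of_forall_notMem [IsNoetherianRing A] (hτ : AutPrime τ)
    (hinf : ∀ i : ℤ, i ≠ 0 → τ ^ i ≠ 1) (J : TwoSidedIdeal (SkewLaurent τ)) {s : SkewLaurent τ}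
    (hs : s ∈ J) (hs0 : s ≠ 0) : ∃ b, (∀ q ∈ minimalPrimes A, b ∉ q) ∧ C τ b ∈ J := by
  obtain ⟨a, ha0, ha⟩ := exists_C_mem_of_ne_zero hτ hinf J hs hs0
  let I : Ideal A := J.asIdeal.comap (C τ)
  have hI : ∀ x, x ∈ I ↔ C τ x ∈ J := fun x => by simp [I]
  by_contra! hcon
  have hfin := minimalPrimes.finite_of_isNoetherianRing A
  have hsub : (I : Set A) ⊆ ⋃ q ∈ (hfin.toFinset : Set (Ideal A)), (q : Ideal A) := by
    intro b hb
    by_contra hbq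
    simp only [Set.Finite.coe_toFinset, Set.mem_iUnion, not_exists] at hbq
    exact hcon b hbq ((hI b).1 hb)
  obtain ⟨q, hq, hIq⟩ := (Ideal.subset_union_prime (f := fun q => q) ⊥ ⊥ fun q hq _ _ =>
    ((hfin.mem_toFinset).1 hq : q ∈ minimalPrimes A).1.1).1 hsub
  rw [hfin.mem_toFinset] at hq
  refine ha0 (hτ.eq_zero_of_forall_mem hq fun i => hIq ((hI _).2 ?_))
  have h1 := J.mul_mem_right _ (monomial τ (-i) 1) (J.mul_mem_left (monomial τ i 1) _ ha)
  rw [C_apply, monomial_mul_monomial, monomial_mul_monomial] at h1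
  simpa [C_apply] using h1

end Ideals

end SkewLaurent

/-! ### The centre of the ring of fractions -/

open scoped nonZeroDivisors in
/-- `j : S → Q` exhibits `Q` as a ring of left fractions of `S`: it is injective, it inverts the
regular elements of `S`, and every element of `Q` has a regular left denominator. -/
structure IsLeftFractionRing {S Q : Type*} [Ring S] [Ring Q] (j : S →+* Q) : Prop where
  injective : Function.Injective j
  isUnit : ∀ s ∈ S⁰, IsUnit (j s)
  exists_denom : ∀ z : Q, ∃ s ∈ S⁰, ∃ t, j s * z = j t

namespace SkewLaurent

open scoped nonZeroDivisors

section Center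

variable {k A Q : Type*} [Field k] [CommRing A] [Algebra k A] {τ : A ≃ₐ[k] A} [Ring Q]
  [Algebra k Q] {j : SkewLaurent τ →ₐ[k] Q}

theorem mem_center_of_commute (hj : IsLeftFractionRing (j : SkewLaurent τ →+* Q)) {z : Q}
    (hC : ∀ a, Commute z (j (C τ a))) (hX : Commute z (j (X τ))) :
    z ∈ Subalgebra.center k Q := by
  have hX' : ∀ n : ℤ, Commute z (j (monomial τ n 1)) := fun n => by
    rw [← X_zpow]
    have h : Commute z (Units.map (j : SkewLaurent τ →* Q) (X τ) : Qˣ) := hX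
    have := h.units_zpow_right n
    rw [← map_zpow] at this
    exact this
  have hS : ∀ s, Commute z (j s) := fun s => by
    induction s using induction_monomial with
    | hm n r => rw [monomial_eq_C_mul, map_mul]; exact (hC r).mul_right (hX' n)
    | ha f g hf hg => rw [map_add]; exact hf.add_right hg
  rw [Subalgebra.mem_center_iff]
  intro w
  obtain ⟨s, hs, t, hst⟩ := hj.exists_denom w
  refine (hj.isUnit s hs).mul_left_cancel ?_
  change j s * w = j t at hst
  change j s * (w * z) = j s * (z * w)
  rw [← mul_assoc, hst, ← mul_assoc, ← (hS s).eq, mul_assoc, hst, (hS t).eq]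

/-- If the centre of the ring of fractions is algebraic over `k`, then no non-constant fibration is
preserved: the quotient of the coordinates of an invariant rational map is central, and if it is a
root of a polynomial over `k`, then it is constant on each component. -/
theorem not_preservesNonconstantFibration_of_isAlgebraic [IsAlgClosed k] [IsNoetherianRing A]
    (hτ : AutPrime τ) (hj : IsLeftFractionRing (j : SkewLaurent τ →+* Q))
    (halg : ∀ z ∈ Subalgebra.center k Q, IsAlgebraic k z) :
    ¬ PreservesNonconstantFibration τ := by
  rintro ⟨f, hf, q, hq, hconst⟩
  have := hτ.isReduced
  have hinv : τ f.num * f.den = f.num * τ f.den :=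
    sub_eq_zero.1 (eq_zero_of_mem_minimalPrimes hf)
  have hden : ∀ q ∈ minimalPrimes A, f.den ∉ q := by
    intro q' hq' hmem
    -- By invariance, the set of components on which `f = ∞` is stable, so `f = ∞` everywhere.
    have h0 : f.den = 0 := by
      refine hτ.eq_zero_of_mem_of_apply_mem hq' hmem (fun p hp h => ?_) (fun p hp h => ?_)
      · have hpp : p.IsPrime := hp.1.1
        have h1 : f.num * τ f.den ∈ p := hinv ▸ Ideal.mul_mem_left _ _ h
        exact (hpp.mem_or_mem h1).resolve_left fun h2 => (f.dense_domain p hp).elim (· h2) (· h)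
      · have hpp : p.IsPrime := hp.1.1
        have h1 : τ f.num * f.den ∈ p := hinv ▸ Ideal.mul_mem_left _ _ h
        exact (hpp.mem_or_mem h1).resolve_left fun h2 =>
          ((f.compAut τ).dense_domain p hp).elim (· h2) (· h)
    refine hconst 1 0 (Or.inl one_ne_zero) ?_
    simp [h0]
  have hden' : ∀ q ∈ minimalPrimes A, τ f.den ∉ q := fun p hp =>
    hden _ (comap_mem_minimalPrimes τ hp)
  have hu := hj.isUnit _ (C_mem_nonZeroDivisors τ hden)
  have hu' := hj.isUnit _ (C_mem_nonZeroDivisors τ hden')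
  change IsUnit (j (C τ f.den)) at hu
  change IsUnit (j (C τ (τ f.den))) at hu'
  have hcomm : ∀ a b, Commute (j (C τ a)) (j (C τ b)) := fun a b => by
    rw [commute_iff_eq, ← map_mul, ← map_mul, ← map_mul, ← map_mul, mul_comm]
  obtain ⟨z, hz⟩ : ∃ z, j (C τ f.den) * z = j (C τ f.num) := by
    obtain ⟨u, hu⟩ := hu
    exact ⟨↑u⁻¹ * j (C τ f.num), by rw [← hu, Units.mul_inv_cancel_left]⟩
  have hzC : ∀ a, Commute z (j (C τ a)) := fun a => by
    refine hu.mul_left_cancel ?_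
    rw [← mul_assoc, hz, ← mul_assoc, (hcomm f.den a).eq, mul_assoc, hz, (hcomm f.num a).eq]
  have hτz : j (C τ (τ f.den)) * z = j (C τ (τ f.num)) := by
    refine hu.mul_left_cancel ?_
    rw [← mul_assoc, (hcomm _ _).eq, mul_assoc, hz, (hcomm _ _).eq, ← map_mul, ← map_mul,
      ← map_mul, ← map_mul, ← hinv, mul_comm]
  have hzX : Commute z (j (X τ)) := by
    refine hu'.mul_left_cancel ?_
    rw [← mul_assoc, hτz, ← mul_assoc, ← map_mul, ← map_mul, ← X_mul_C, ← X_mul_C, map_mul,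
      map_mul, mul_assoc, hz]
  obtain ⟨p, hp0, hp⟩ := halg z (mem_center_of_commute hj hzC hzX)
  -- Clearing denominators turns a factorization of `p` into a relation in `A`.
  have key : ∀ m : Multiset k, j (C τ f.den) ^ Multiset.card m *
      Polynomial.aeval z (m.map fun a => Polynomial.X - Polynomial.C a).prod =
        j (C τ (m.map fun a => f.num - a • f.den).prod) := fun m => by
    induction m using Multiset.induction_on with
    | empty => simp
    | cons a m ih =>
      have h1 : j (C τ f.den) * Polynomial.aeval z (Polynomial.X - Polynomial.C a) =
          j (C τ (f.num - a • f.den)) := by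
        rw [map_sub, Polynomial.aeval_X, Polynomial.aeval_C, mul_sub, hz, map_sub, map_sub,
          Algebra.smul_def, map_mul, map_mul, ← algebraMap_eq, AlgHom.commutes,
          Algebra.commutes]
      have h2 : Commute (j (C τ f.den) ^ Multiset.card m) (j (C τ (f.num - a • f.den))) :=
        (hcomm _ _).pow_left _
      rw [Multiset.map_cons, Multiset.prod_cons, Multiset.map_cons, Multiset.prod_cons,
        Multiset.card_cons, map_mul, map_mul, map_mul, ← ih, ← h1, pow_succ, mul_assoc,
        ← mul_assoc _ _ (Polynomial.aeval z (Multiset.prod _)), h1, ← mul_assoc, h2.eq, mul_assoc]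
  have hprod : (p.roots.map fun a => f.num - a • f.den).prod = 0 := by
    apply C_injective τ
    apply hj.injective
    change j _ = j _
    rw [← key, map_zero, map_zero]
    have h2 := (IsAlgClosed.splits p).eq_prod_roots
    rw [h2, map_mul, Polynomial.aeval_C] at hp
    have h3 : IsUnit (algebraMap k Q p.leadingCoeff) :=
      (isUnit_iff_ne_zero.2 (Polynomial.leadingCoeff_ne_zero.2 hp0)).map _
    rw [h3.mul_right_eq_zero] at hp
    rw [hp, mul_zero]
  have hqp : q.IsPrime := hq.1.1
  have hmem : (p.roots.map fun a => f.num - a • f.den).prod ∈ q := hprod ▸ q.zero_mem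
  rw [hqp.multiset_prod_mem_iff_exists_mem] at hmem
  obtain ⟨x, hx, hxq⟩ := hmem
  obtain ⟨a, -, rfl⟩ := Multiset.mem_map.1 hx
  exact hconst a 1 (Or.inr one_ne_zero) (by simpa using hxq)

/-- The two-sided ideal of the left denominators of a central element `z`. -/
noncomputable def denominatorIdeal (j : SkewLaurent τ →ₐ[k] Q) {z : Q}
    (hz : z ∈ Subalgebra.center k Q) :
    TwoSidedIdeal (SkewLaurent τ) :=
  TwoSidedIdeal.mk' {s | ∃ t, j s * z = j t}
    ⟨0, by simp⟩
    (by
      rintro s s' ⟨t, ht⟩ ⟨t', ht'⟩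
      exact ⟨t + t', by rw [map_add, map_add, add_mul, ht, ht']⟩)
    (by
      rintro s ⟨t, ht⟩
      exact ⟨-t, by rw [map_neg, map_neg, neg_mul, ht]⟩)
    (by
      rintro u s ⟨t, ht⟩
      exact ⟨u * t, by rw [map_mul, map_mul, mul_assoc, ht]⟩)
    (by
      rintro s u ⟨t, ht⟩
      refine ⟨t * u, ?_⟩
      rw [map_mul, map_mul, mul_assoc, Subalgebra.mem_center_iff.1 hz, ← mul_assoc, ht])

theorem mem_denominatorIdeal {z : Q} (hz : z ∈ Subalgebra.center k Q) (s : SkewLaurent τ) :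
    s ∈ denominatorIdeal j hz ↔ ∃ t, j s * z = j t := by
  rw [denominatorIdeal, TwoSidedIdeal.mem_mk']
  rfl

/-- If a constant `b` is a denominator of a central element `z`, then the numerator is a constant
`t`, and `t / b` is invariant. -/
theorem exists_mul_eq_C_of_mem_denominatorIdeal (hτ : AutPrime τ)
    (hinf : ∀ i : ℤ, i ≠ 0 → τ ^ i ≠ 1) (hinj : Function.Injective j) {z : Q}
    (hz : z ∈ Subalgebra.center k Q) {b : A} (hb : C τ b ∈ denominatorIdeal j hz) :
    ∃ t, j (C τ b) * z = j (C τ t) ∧ τ b * t = b * τ t := by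
  have hz' := Subalgebra.mem_center_iff.1 hz
  obtain ⟨s, hs⟩ := (mem_denominatorIdeal hz _).1 hb
  have hsC : s = C τ (coeff τ s 0) := by
    refine eq_C_of_commute hτ hinf fun r => hinj ?_
    rw [map_mul, map_mul, ← hs, ← mul_assoc, ← map_mul, ← map_mul, mul_comm r b, map_mul, map_mul,
      mul_assoc, hz', ← mul_assoc]
  rw [hsC] at hs
  generalize coeff τ s 0 = t at hs
  refine ⟨t, hs, ?_⟩
  have h1 : j (C τ (τ b)) * z = j (C τ (τ t)) := by
    refine (((X τ).isUnit.map j).mul_left_inj).1 ?_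
    rw [mul_assoc, ← hz', ← mul_assoc, ← map_mul, ← map_mul, ← X_mul_C, ← X_mul_C, map_mul,
      map_mul, mul_assoc, hs]
  apply C_injective τ
  apply hinj
  rw [map_mul, map_mul, map_mul, map_mul, ← hs, ← h1, ← mul_assoc, ← mul_assoc, ← map_mul,
    ← map_mul, ← map_mul, ← map_mul, mul_comm]

/-- If no non-constant fibration is preserved, then the centre of the ring of fractions is `k`. -/
theorem isAlgebraic_of_not_preservesNonconstantFibration [IsNoetherianRing A]
    (hτ : AutPrime τ) (hinf : ∀ i : ℤ, i ≠ 0 → τ ^ i ≠ 1)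
    (hj : IsLeftFractionRing (j : SkewLaurent τ →+* Q)) [Nontrivial A]
    (hfib : ¬ PreservesNonconstantFibration τ) {z : Q} (hz : z ∈ Subalgebra.center k Q) :
    IsAlgebraic k z := by
  have := hτ.isReduced
  obtain ⟨s, hs, t, hst⟩ := hj.exists_denom z
  have hnt : Nontrivial (SkewLaurent τ) := (C_injective τ).nontrivial
  obtain ⟨b, hb, hbJ⟩ := exists_C_mem_of_forall_notMem hτ hinf (denominatorIdeal j hz)
    ((mem_denominatorIdeal hz s).2 ⟨t, hst⟩) (nonZeroDivisors.ne_zero hs)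
  obtain ⟨t, hbt, hinv⟩ := exists_mul_eq_C_of_mem_denominatorIdeal hτ hinf hj.injective hz hbJ
  obtain ⟨q, hq⟩ : Nonempty (minimalPrimes A) := Ideal.nonempty_minimalPrimes bot_ne_top
  obtain ⟨c, hc⟩ : ∃ c : k, t - c • b ∈ q := by
    by_contra! hcon
    refine hfib ⟨⟨t, b, fun q hq => Or.inr (hb q hq)⟩, fun q hq => ?_, q, hq, ?_⟩
    · change τ t * b - t * τ b ∈ q
      rw [mul_comm t, hinv, mul_comm b, sub_self]
      exact q.zero_mem
    · intro c d hcd hmem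
      change d • t - c • b ∈ q at hmem
      by_cases hd : d = 0
      · have hc0 : c ≠ 0 := hcd.resolve_right (not_not.2 hd)
        rw [hd, zero_smul, zero_sub, neg_mem_iff] at hmem
        have := Submodule.smul_of_tower_mem q c⁻¹ hmem
        rw [smul_smul, inv_mul_cancel₀ hc0, one_smul] at this
        exact hb q hq this
      · have := Submodule.smul_of_tower_mem q d⁻¹ hmem
        rw [smul_sub, smul_smul, smul_smul, inv_mul_cancel₀ hd, one_smul] at this
        exact hcon _ this
  -- By invariance, `t / b = c` on one component implies `t / b = c` on all of them.
  have hrel : τ b * (t - c • b) = b * τ (t - c • b) := by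
    rw [map_sub, map_smul, mul_sub, mul_sub, hinv, mul_smul_comm, mul_smul_comm, mul_comm b (τ b)]
  have h0 : t - c • b = 0 := by
    refine hτ.eq_zero_of_mem_of_apply_mem hq hc (fun p hp h => ?_) (fun p hp h => ?_)
    · have hpp : p.IsPrime := hp.1.1
      exact (hpp.mem_or_mem (hrel ▸ Ideal.mul_mem_left _ _ h)).resolve_left (hb p hp)
    · have hpp : p.IsPrime := hp.1.1
      have h1 : τ b * (t - c • b) ∈ p := hrel ▸ Ideal.mul_mem_left _ _ h
      exact (hpp.mem_or_mem h1).resolve_left (hb _ (comap_mem_minimalPrimes τ hp))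
  have hzc : z = algebraMap k Q c := by
    refine (hj.isUnit _ (C_mem_nonZeroDivisors τ hb)).mul_left_cancel ?_
    change j (C τ b) * z = j (C τ b) * _
    rw [hbt, sub_eq_zero.1 h0, ← Algebra.commutes, ← j.commutes, ← map_mul, algebraMap_eq,
      ← map_mul, Algebra.smul_def]
  rw [hzc]
  exact isAlgebraic_algebraMap c

/-- If `A[x^{±1}; τ]` is simple, then the centre of its ring of fractions is `k`. -/
theorem isAlgebraic_of_isSimple [IsAlgClosed k] [Algebra.FiniteType k A] [Nontrivial A]
    (hτ : AutPrime τ) (hinf : ∀ i : ℤ, i ≠ 0 → τ ^ i ≠ 1)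
    (hj : IsLeftFractionRing (j : SkewLaurent τ →+* Q))
    (hsimple : ∀ J : TwoSidedIdeal (SkewLaurent τ), ∀ s ∈ J, s ≠ 0 → (1 : SkewLaurent τ) ∈ J)
    {z : Q} (hz : z ∈ Subalgebra.center k Q) : IsAlgebraic k z := by
  have hnt : Nontrivial (SkewLaurent τ) := (C_injective τ).nontrivial
  obtain ⟨s, hs, t, hst⟩ := hj.exists_denom z
  have h1 : C τ 1 ∈ denominatorIdeal j hz := by
    rw [map_one]
    exact hsimple _ s ((mem_denominatorIdeal hz s).2 ⟨t, hst⟩) (nonZeroDivisors.ne_zero hs)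
  obtain ⟨t, ht, hinv⟩ := exists_mul_eq_C_of_mem_denominatorIdeal hτ hinf hj.injective hz h1
  rw [map_one, one_mul, one_mul] at hinv
  rw [map_one, map_one, one_mul] at ht
  obtain ⟨m, hm⟩ := Ideal.exists_maximal A
  obtain ⟨c, hc⟩ := exists_sub_algebraMap_mem_of_isMaximal (k := k) m t
  set a := t - algebraMap k A c with ha
  have hτa : ∀ i : ℤ, (τ ^ i) a = a := by
    have h1 : τ ∈ MulAction.stabilizer (A ≃ₐ[k] A) a := by
      change τ a = a
      rw [ha, map_sub, ← hinv, AlgEquiv.commutes]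
    exact fun i => zpow_mem h1 i
  have hcomm : ∀ u, u * C τ a = C τ a * u := fun u => by
    ext i
    rw [coeff_mul_C, coeff_C_mul, hτa, mul_comm]
  -- The central element `a` is not a unit, since it lies in `m`, so the ideal it generates is zero.
  let J : TwoSidedIdeal (SkewLaurent τ) := TwoSidedIdeal.mk' {s | ∃ u, s = C τ a * u}
    ⟨0, by simp⟩
    (by
      rintro _ _ ⟨u, rfl⟩ ⟨v, rfl⟩
      exact ⟨u + v, by rw [mul_add]⟩)
    (by
      rintro _ ⟨u, rfl⟩
      exact ⟨-u, by rw [mul_neg]⟩)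
    (by
      rintro v _ ⟨u, rfl⟩
      exact ⟨v * u, by rw [← mul_assoc, hcomm, mul_assoc]⟩)
    (by
      rintro _ v ⟨u, rfl⟩
      exact ⟨u * v, by rw [mul_assoc]⟩)
  have hJ : ∀ s, s ∈ J ↔ ∃ u, s = C τ a * u := fun s => by
    rw [TwoSidedIdeal.mem_mk']
    rfl
  have ha0 : a = 0 := by
    by_contra ha0
    obtain ⟨u, hu⟩ := (hJ 1).1 (hsimple J (C τ a) ((hJ _).2 ⟨1, by rw [mul_one]⟩)
      ((map_ne_zero_iff _ (C_injective τ)).2 ha0))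
    have := congrArg (fun f => coeff τ f 0) hu
    simp only [coeff_one, coeff_C_mul, Finsupp.single_eq_same] at this
    refine hm.ne_top ((Ideal.eq_top_iff_one m).2 ?_)
    rw [this]
    exact Ideal.mul_mem_right _ _ hc
  rw [ht, sub_eq_zero.1 (ha.symm.trans ha0), ← algebraMap_eq, AlgHom.commutes]
  exact isAlgebraic_algebraMap c

end Center

end SkewLaurent

/-! ### Finite-dimensional prime algebras -/

section PrimeAlgebra

open scoped nonZeroDivisors

variable {k T : Type*} [Field k] [Ring T] [Algebra k T]

/-- A finite-dimensional prime algebra is simple: its Jacobson radical is nilpotent, hence zero, so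
a two-sided ideal is generated by an idempotent `e`, and it annihilates `1 - e`. -/
theorem one_mem_of_mem_of_ne_zero [Module.Finite k T]
    (hT : ∀ a b : T, (∀ t, a * t * b = 0) → a = 0 ∨ b = 0) (J : TwoSidedIdeal T) {s : T}
    (hs : s ∈ J) (hs0 : s ≠ 0) : (1 : T) ∈ J := by
  have : IsArtinianRing T := IsArtinianRing.of_finite k T
  have hjac : Ring.jacobson T = ⊥ := by
    by_contra hne
    obtain ⟨b, hb, hb0⟩ := Submodule.exists_mem_ne_zero_of_ne_bot hne
    obtain ⟨n, hn⟩ := IsSemiprimaryRing.isNilpotent (R := T)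
    have : ∀ m, Ring.jacobson T ^ m = ⊥ → False := by
      intro m
      induction m with
      | zero =>
        intro h0
        rw [Submodule.pow_zero, Ideal.one_eq_top] at h0
        exact hne (le_bot_iff.1 (h0 ▸ le_top))
      | succ m ih =>
        intro hm
        refine ih (le_bot_iff.1 fun c hc => ?_)
        refine (hT b c fun t => ?_).resolve_left hb0
        rw [← Ideal.mem_bot, ← hm, Ideal.IsTwoSided.pow_succ, mul_assoc]
        exact Ideal.mul_mem_mul hb (Ideal.mul_mem_left _ _ hc)
    exact this n hn
  have : IsSemisimpleRing T := IsArtinianRing.isSemisimpleRing_iff_jacobson.2 hjac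
  obtain ⟨e, he, hJe⟩ := IsSemisimpleRing.ideal_eq_span_idempotent J.asIdeal
  have hmem : ∀ x, x ∈ J ↔ ∃ a, a * e = x := fun x => by
    rw [← TwoSidedIdeal.mem_asIdeal, hJe, Ideal.mem_span_singleton']
  have h0 : 1 - e = 0 := (hT s (1 - e) fun t => by
    obtain ⟨a, ha⟩ := (hmem _).1 (J.mul_mem_right s t hs)
    rw [← ha, mul_assoc, mul_sub, mul_one, he.eq, sub_self, mul_zero]).resolve_left hs0
  exact (hmem 1).2 ⟨1, by rw [one_mul, sub_eq_zero.1 h0]⟩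

theorem isUnit_of_mem_nonZeroDivisors_of_finite [Module.Finite k T] {s : T} (hs : s ∈ T⁰) :
    IsUnit s := by
  have hinj : Function.Injective (LinearMap.mulLeft k s) := by
    rw [← LinearMap.ker_eq_bot, LinearMap.ker_eq_bot']
    exact fun m hm => hs.1 m hm
  obtain ⟨t, ht⟩ := LinearMap.injective_iff_surjective.1 hinj 1
  rw [LinearMap.mulLeft_apply] at ht
  have ht' : t * s = 1 := by
    refine sub_eq_zero.1 (hs.1 _ ?_)
    rw [mul_sub, ← mul_assoc, ht, one_mul, mul_one, sub_self]
  exact ⟨⟨s, t, ht, ht'⟩, rfl⟩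

/-- A central element of a prime algebra that is algebraic over `k` is a scalar: one of the linear
factors of its polynomial relation must vanish. -/
theorem exists_eq_algebraMap_of_commute [IsAlgClosed k] [Nontrivial T]
    (hT : ∀ a b : T, (∀ t, a * t * b = 0) → a = 0 ∨ b = 0) {w : T} (hw : ∀ t, Commute w t)
    (halg : IsAlgebraic k w) : ∃ c : k, w = algebraMap k T c := by
  obtain ⟨p, hp0, hp⟩ := halg
  have key : ∀ m : Multiset k,
      Polynomial.aeval w (m.map fun a => Polynomial.X - Polynomial.C a).prod = 0 →
        ∃ c : k, w = algebraMap k T c := fun m => by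
    induction m using Multiset.induction_on with
    | empty => simp
    | cons a m ih =>
      intro h
      rw [Multiset.map_cons, Multiset.prod_cons, map_mul, map_sub, Polynomial.aeval_X,
        Polynomial.aeval_C] at h
      have hc : ∀ t, Commute (w - algebraMap k T a) t := fun t =>
        (hw t).sub_left (Algebra.commutes a t)
      rcases hT _ _ (fun t => by rw [(hc t).eq, mul_assoc, h, mul_zero]) with h1 | h1
      · exact ⟨a, sub_eq_zero.1 h1⟩
      · exact ih h1
  have h2 := (IsAlgClosed.splits p).eq_prod_roots
  rw [h2, map_mul, Polynomial.aeval_C] at hp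
  have h3 : IsUnit (algebraMap k T p.leadingCoeff) :=
    (isUnit_iff_ne_zero.2 (Polynomial.leadingCoeff_ne_zero.2 hp0)).map _
  rw [h3.mul_right_eq_zero] at hp
  exact key _ hp

theorem finite_of_forall_algebraMap_eq (Z : Type*) [CommRing Z] [Algebra Z T] [Module.Finite Z T]
    (h : ∀ z : Z, ∃ c : k, algebraMap Z T z = algebraMap k T c) : Module.Finite k T := by
  obtain ⟨t, ht⟩ := Module.Finite.fg_top (R := Z) (M := T)
  refine ⟨t, eq_top_iff.2 fun x _ => ?_⟩
  have hx : x ∈ Submodule.span Z (t : Set T) := ht ▸ Submodule.mem_top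
  induction hx using Submodule.span_induction with
  | mem x hx => exact Submodule.subset_span hx
  | zero => exact zero_mem _
  | add x y _ _ hx hy => exact add_mem (hx trivial) (hy trivial)
  | smul z x _ hx =>
    obtain ⟨c, hc⟩ := h z
    rw [Algebra.smul_def, hc, ← Algebra.smul_def]
    exact Submodule.smul_mem _ _ (hx trivial)

/-- A simple algebra that is finite over an affine central subalgebra is finite-dimensional: by
Nakayama's lemma a maximal ideal of the subalgebra generates a proper ideal, hence the zero ideal,
so the subalgebra acts through the residue field `k`. -/
theorem finite_of_isSimple [IsAlgClosed k] [Nontrivial T] (Z : Type*) [CommRing Z] [Algebra k Z]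
    [Algebra Z T] [IsScalarTower k Z T] [Algebra.FiniteType k Z] [Module.Finite Z T]
    (hsimple : ∀ J : TwoSidedIdeal T, ∀ s ∈ J, s ≠ 0 → (1 : T) ∈ J) : Module.Finite k T := by
  obtain ⟨M, hM, hker⟩ := Ideal.exists_le_maximal (RingHom.ker (algebraMap Z T))
    (RingHom.ker_ne_top _)
  let N : Submodule Z T := M • (⊤ : Submodule Z T)
  have hN1 : (1 : T) ∉ N := fun h1 => by
    have hle : (⊤ : Submodule Z T) ≤ N := fun x _ => by
      refine Submodule.smul_induction_on (p := fun y => x * y ∈ N) h1 (fun m hm y _ => ?_)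
        (fun y y' hy hy' => ?_) |> fun h => by simpa using h
      · rw [mul_smul_comm]
        exact Submodule.smul_mem_smul hm trivial
      · rw [mul_add]
        exact add_mem hy hy'
    obtain ⟨r, hr, hr0⟩ := Submodule.exists_sub_one_mem_and_smul_eq_zero_of_fg_of_le_smul M ⊤
      Module.Finite.fg_top hle
    have hrM : r ∈ M := hker (by
      rw [RingHom.mem_ker, Algebra.algebraMap_eq_smul_one]
      exact hr0 1 trivial)
    refine hM.ne_top ((Ideal.eq_top_iff_one M).2 ?_)
    simpa using sub_mem hrM hr
  let J : TwoSidedIdeal T := TwoSidedIdeal.mk' N (zero_mem N) (fun h h' => add_mem h h')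
    (fun h => neg_mem h)
    (fun {x y} h => by
      refine Submodule.smul_induction_on (p := fun y => x * y ∈ N) h (fun m hm y _ => ?_)
        (fun y y' hy hy' => ?_)
      · rw [mul_smul_comm]
        exact Submodule.smul_mem_smul hm trivial
      · rw [mul_add]
        exact add_mem hy hy')
    (fun {x y} h => by
      refine Submodule.smul_induction_on (p := fun x => x * y ∈ N) h (fun m hm x _ => ?_)
        (fun x x' hx hx' => ?_)
      · rw [smul_mul_assoc]
        exact Submodule.smul_mem_smul hm trivial
      · rw [add_mul]
        exact add_mem hx hx')
  have hJ : ∀ x, x ∈ J ↔ x ∈ N := fun x => by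
    rw [TwoSidedIdeal.mem_mk']
    rfl
  refine finite_of_forall_algebraMap_eq Z fun z => ?_
  obtain ⟨c, hc⟩ := exists_sub_algebraMap_mem_of_isMaximal (k := k) M z
  refine ⟨c, ?_⟩
  by_contra hne
  refine hN1 ((hJ 1).1 (hsimple J (algebraMap Z T (z - algebraMap k Z c)) ((hJ _).2 ?_) ?_))
  · rw [Algebra.algebraMap_eq_smul_one]
    exact Submodule.smul_mem_smul hc trivial
  · rwa [map_sub, ← IsScalarTower.algebraMap_apply, sub_ne_zero]

end PrimeAlgebra

/-! ### Automorphisms of finite order -/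

section FiniteOrder

variable {k : Type*} {A : Type*} [Field k] [CommRing A] [Algebra k A] (τ : A ≃ₐ[k] A)

/-- The subalgebra of elements fixed by `τ`. -/
def fixedSubalgebra : Subalgebra k A := AlgHom.equalizer (τ : A →ₐ[k] A) (AlgHom.id k A)

theorem isIntegral_fixedSubalgebra (hfin : IsOfFinOrder τ) :
    Algebra.IsIntegral (fixedSubalgebra τ) A := by
  have : Finite (Subgroup.zpowers τ) := hfin.finite_zpowers
  have : Algebra.IsInvariant (fixedSubalgebra τ) A (Subgroup.zpowers τ) :=
    ⟨fun b hb => ⟨⟨b, hb ⟨τ, Subgroup.mem_zpowers τ⟩⟩, rfl⟩⟩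
  exact Algebra.IsInvariant.isIntegral (fixedSubalgebra τ) A (Subgroup.zpowers τ)

theorem finite_fixedSubalgebra [Algebra.FiniteType k A] (hfin : IsOfFinOrder τ) :
    Module.Finite (fixedSubalgebra τ) A := by
  have := isIntegral_fixedSubalgebra τ hfin
  have : Algebra.FiniteType (fixedSubalgebra τ) A :=
    Algebra.FiniteType.of_restrictScalars_finiteType k _ A
  exact Algebra.IsIntegral.finite

/-- By the Artin–Tate lemma, the fixed subalgebra is affine. -/
theorem finiteType_fixedSubalgebra [Algebra.FiniteType k A] (hfin : IsOfFinOrder τ) :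
    Algebra.FiniteType k (fixedSubalgebra τ) :=
  ⟨fg_of_fg_of_fg k (fixedSubalgebra τ) A Algebra.FiniteType.out
    (finite_fixedSubalgebra τ hfin).fg_top Subtype.val_injective⟩

namespace SkewLaurent

/-- If `τ` has finite order, then every quotient of `A[x^{±1}; τ]` is finite over an affine central
subalgebra. With `m` the order of `τ` and `B` the fixed subalgebra, the latter is the image of
`B[y₁, y₂]` under `y₁ ↦ x^m` and `y₂ ↦ x^(-m)`. -/
theorem exists_finite_over_central [Algebra.FiniteType k A] (hfin : IsOfFinOrder τ) {T : Type*}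
    [Ring T] [Algebra k T] (π : SkewLaurent τ →ₐ[k] T) (hπ : Function.Surjective π) :
    ∃ (_ : Algebra (MvPolynomial Bool (fixedSubalgebra τ)) T),
      Algebra.FiniteType k (MvPolynomial Bool (fixedSubalgebra τ)) ∧
      IsScalarTower k (MvPolynomial Bool (fixedSubalgebra τ)) T ∧
      Module.Finite (MvPolynomial Bool (fixedSubalgebra τ)) T := by
  classical
  obtain ⟨m, hm, hm1⟩ := hfin.exists_pow_eq_one
  have hmz : ∀ n : ℤ, τ ^ ((m : ℤ) * n) = 1 := fun n => by
    rw [zpow_mul, zpow_natCast, hm1, one_zpow]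
  have hfix : ∀ b : fixedSubalgebra τ, ∀ i : ℤ, (τ ^ i) (b : A) = b := fun b i => by
    have h1 : τ ∈ MulAction.stabilizer (A ≃ₐ[k] A) (b : A) := b.2
    exact zpow_mem h1 i
  have hcC : ∀ (b : fixedSubalgebra τ) (s : SkewLaurent τ), Commute (C τ (b : A)) s := by
    intro b s
    ext i
    rw [coeff_mul_C, coeff_C_mul, hfix, mul_comm]
  have hcX : ∀ (n : ℤ) (s : SkewLaurent τ), Commute (monomial τ (m * n) 1) s := by
    intro n s
    ext i
    rw [coeff_mul_monomial, coeff_monomial_mul, hmz]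
    simp
  let f : fixedSubalgebra τ →+* Subalgebra.center k (SkewLaurent τ) :=
    ((C τ).comp (fixedSubalgebra τ).val.toRingHom).codRestrict _ fun b =>
      Subalgebra.mem_center_iff.2 fun s => (hcC b s).eq.symm
  let g : Bool → Subalgebra.center k (SkewLaurent τ) := fun b =>
    ⟨monomial τ (m * bif b then 1 else -1) 1,
      Subalgebra.mem_center_iff.2 fun s => (hcX _ s).eq.symm⟩
  let ψ : MvPolynomial Bool (fixedSubalgebra τ) →+* SkewLaurent τ :=
    (Subalgebra.center k (SkewLaurent τ)).val.toRingHom.comp (MvPolynomial.eval₂Hom f g)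
  have hψc : ∀ p s, Commute (ψ p) s := fun p s =>
    (Subalgebra.mem_center_iff.1 (MvPolynomial.eval₂Hom f g p).2 s).symm
  have hψC : ∀ b, ψ (MvPolynomial.C b) = C τ (b : A) := fun b => by
    change ((MvPolynomial.eval₂Hom f g (MvPolynomial.C b) : Subalgebra.center k _) :
      SkewLaurent τ) = _
    rw [MvPolynomial.eval₂Hom_C]
    rfl
  have hψX : ∀ n : ℤ, ∃ p, ψ p = monomial τ (m * n) 1 := by
    have hX : ∀ (b : Bool) (n : ℕ), ψ (MvPolynomial.X b ^ n) =
        monomial τ (m * ((bif b then 1 else -1) * n)) 1 := fun b n => by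
      induction n with
      | zero => simp; rfl
      | succ n ih =>
        have h1 : ψ (MvPolynomial.X b) = monomial τ (m * bif b then 1 else -1) 1 := by
          change ((MvPolynomial.eval₂Hom f g (MvPolynomial.X b) : Subalgebra.center k _) :
            SkewLaurent τ) = _
          rw [MvPolynomial.eval₂Hom_X']
        rw [pow_succ, map_mul, ih, h1, monomial_mul_monomial, map_one, mul_one, ← mul_add]
        congr 2
        push_cast
        ring
    intro n
    obtain ⟨n, rfl | rfl⟩ := n.eq_nat_or_neg
    · exact ⟨MvPolynomial.X true ^ n, by simpa using hX true n⟩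
    · exact ⟨MvPolynomial.X false ^ n, by simpa using hX false n⟩
  let alg : Algebra (MvPolynomial Bool (fixedSubalgebra τ)) T :=
    RingHom.toAlgebra' ((π : SkewLaurent τ →+* T).comp ψ) fun p t => by
      obtain ⟨s, rfl⟩ := hπ t
      change π (ψ p) * π s = π s * π (ψ p)
      rw [← map_mul, (hψc p s).eq, map_mul]
  have hsmul : ∀ p t, p • t = π (ψ p) * t := fun p t => rfl
  have hB := finiteType_fixedSubalgebra τ hfin
  refine ⟨alg, hB.trans inferInstance, ?_, ?_⟩
  · refine IsScalarTower.of_algebraMap_eq fun c => ?_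
    change _ = π (ψ (MvPolynomial.C (algebraMap k _ c)))
    rw [hψC, ← π.commutes]
    rfl
  · obtain ⟨t, ht⟩ := (finite_fixedSubalgebra τ hfin).fg_top
    let u : Finset T := (t ×ˢ Finset.range m).image fun x => π (monomial τ (x.2 : ℤ) x.1)
    refine ⟨u, eq_top_iff.2 fun x hx => ?_⟩
    clear hx
    obtain ⟨s, rfl⟩ := hπ x
    induction s using induction_monomial with
    | ha s s' hs hs' => rw [map_add]; exact add_mem hs hs'
    | hm n r =>
      have hr : r ∈ Submodule.span (fixedSubalgebra τ) (t : Set A) := ht ▸ Submodule.mem_top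
      induction hr using Submodule.span_induction with
      | zero =>
        rw [← coeff_symm_single, Finsupp.single_zero, map_zero, map_zero]
        exact zero_mem _
      | add r r' _ _ hr hr' => rw [monomial_add, map_add]; exact add_mem hr hr'
      | smul b r _ hr =>
        have : monomial τ n (b • r) = ψ (MvPolynomial.C b) * monomial τ n r := by
          rw [hψC, monomial_eq_C_mul, monomial_eq_C_mul τ n r, ← mul_assoc, ← map_mul]
          rfl
        rw [this, map_mul, ← hsmul]
        exact Submodule.smul_mem _ _ hr
      | mem r hr =>
        obtain ⟨p, hp⟩ := hψX (n / m)
        have : monomial τ n r = ψ p * monomial τ ((n % m).toNat : ℤ) r := by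
          have hm0 : (m : ℤ) ≠ 0 := by exact_mod_cast hm.ne'
          rw [hp, monomial_mul_monomial, hmz, Int.toNat_of_nonneg (Int.emod_nonneg _ hm0),
            Int.mul_ediv_add_emod]
          simp
        rw [this, map_mul, ← hsmul]
        refine Submodule.smul_mem _ _ (Submodule.subset_span ?_)
        have hlt : (n % m).toNat < m := by
          have := Int.emod_lt_of_pos n (show (0 : ℤ) < m by exact_mod_cast hm)
          lia
        exact Finset.mem_coe.2 (Finset.mem_image.2
          ⟨(r, (n % m).toNat), Finset.mem_product.2 ⟨hr, Finset.mem_range.2 hlt⟩, rfl⟩)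

end SkewLaurent

/-- An automorphism of finite order of a positive-dimensional variety preserves a non-constant
fibration: otherwise all invariant functions are constant, and the ring is integral over them. -/
theorem preservesNonconstantFibration_of_isOfFinOrder [Algebra.FiniteType k A] {τ : A ≃ₐ[k] A}
    (hτ : AutPrime τ) (hfin : IsOfFinOrder τ) (hinf : ¬ Module.Finite k A) :
    PreservesNonconstantFibration τ := by
  have : IsNoetherianRing A := Algebra.FiniteType.isNoetherianRing k A
  by_contra hfib
  have hnt : Nontrivial A := by
    by_contra h
    rw [not_nontrivial_iff_subsingleton] at h
    exact hinf inferInstance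
  obtain ⟨q, hq⟩ : Nonempty (minimalPrimes A) := Ideal.nonempty_minimalPrimes bot_ne_top
  have hone : ∀ q ∈ minimalPrimes A, (1 : A) ∉ q := fun q hq h =>
    hq.1.1.ne_top ((Ideal.eq_top_iff_one q).2 h)
  have hscalar : ∀ a, τ a = a → ∃ c : k, a = algebraMap k A c := by
    intro a ha
    obtain ⟨c, hc⟩ : ∃ c : k, a - c • 1 ∈ q := by
      by_contra! hcon
      refine hfib ⟨⟨a, 1, fun q hq => Or.inr (hone q hq)⟩, fun q hq => ?_, q, hq, ?_⟩
      · change τ a * 1 - a * τ 1 ∈ q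
        rw [ha, map_one, sub_self]
        exact q.zero_mem
      · intro c d hcd hmem
        change d • a - c • 1 ∈ q at hmem
        by_cases hd : d = 0
        · have hc0 : c ≠ 0 := hcd.resolve_right (not_not.2 hd)
          rw [hd, zero_smul, zero_sub, neg_mem_iff] at hmem
          have := Submodule.smul_of_tower_mem q c⁻¹ hmem
          rw [smul_smul, inv_mul_cancel₀ hc0, one_smul] at this
          exact hone q hq this
        · have := Submodule.smul_of_tower_mem q d⁻¹ hmem
          rw [smul_sub, smul_smul, smul_smul, inv_mul_cancel₀ hd, one_smul] at this
          exact hcon _ this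
    have hinv : τ (a - c • 1) = a - c • 1 := by rw [map_sub, map_smul, map_one, ha]
    refine ⟨c, ?_⟩
    rw [Algebra.algebraMap_eq_smul_one]
    exact sub_eq_zero.1 (hτ.eq_zero_of_mem_of_apply_mem hq hc (fun _ _ h => by rwa [hinv])
      (fun _ _ h => by rwa [hinv] at h))
  have := finite_fixedSubalgebra τ hfin
  exact hinf (finite_of_forall_algebraMap_eq (fixedSubalgebra τ) fun b => hscalar b b.2)

/-- An automorphism of a finite reduced algebra has finite order: a power that stabilizes the
minimal primes acts trivially on the residue fields, which are all equal to `k`. -/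
theorem isOfFinOrder_of_finite_of_isReduced [IsAlgClosed k] [Module.Finite k A] [IsReduced A] :
    IsOfFinOrder τ := by
  have : IsNoetherianRing A := IsNoetherianRing.of_finite k A
  obtain ⟨n, hn, hnq⟩ := exists_pow_stabilizes_minimalPrimes τ
  refine isOfFinOrder_iff_pow_eq_one.2 ⟨n, hn, AlgEquiv.ext fun a => ?_⟩
  refine sub_eq_zero.1 (eq_zero_of_mem_minimalPrimes fun q hq => ?_)
  have hqp : q.IsPrime := hq.1.1
  obtain ⟨c, hc⟩ := (IsAlgClosed.algebraMap_bijective_of_isIntegral (k := k) (K := A ⧸ q)).2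
    (Ideal.Quotient.mk q a)
  have h1 : a - algebraMap k A c ∈ q := Ideal.Quotient.eq.1 hc.symm
  have h2 := (hnq n dvd_rfl q hq _).2 h1
  rw [zpow_natCast, map_sub, AlgEquiv.commutes] at h2
  have := sub_mem h2 h1
  rwa [sub_sub_sub_cancel_right] at this

end FiniteOrder

/-! ### The ring of fractions as an Ore localization -/

section OreLocalization

open scoped nonZeroDivisors

theorem isLeftFractionRing_numeratorRingHom (T : Type*) [Ring T] [OreLocalization.OreSet T⁰] :
    IsLeftFractionRing (OreLocalization.numeratorRingHom : T →+* OreLocalization T⁰ T) where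
  injective := OreLocalization.numeratorHom_inj inf_le_left
  isUnit s hs := OreLocalization.numerator_isUnit ⟨s, hs⟩
  exists_denom z := by
    induction z using OreLocalization.ind with
    | _ r s =>
      refine ⟨s, s.2, r, ?_⟩
      change ((s : T) /ₒ (1 : T⁰)) * (r /ₒ s) = r /ₒ 1
      exact OreLocalization.mul_cancel

theorem map_mem_nonZeroDivisors_iff_of_bijective {S T : Type*} [Ring S] [Ring T] {φ : S →+* T}
    (hφ : Function.Bijective φ) {s : S} : φ s ∈ T⁰ ↔ s ∈ S⁰ := by
  simp only [mem_nonZeroDivisors_iff, hφ.2.forall, ← map_mul, map_eq_zero_iff φ hφ.1]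

theorem IsLeftFractionRing.comp {S T Q : Type*} [Ring S] [Ring T] [Ring Q] {j : T →+* Q}
    (hj : IsLeftFractionRing j) {φ : S →+* T} (hφ : Function.Bijective φ) :
    IsLeftFractionRing (j.comp φ) where
  injective := hj.injective.comp hφ.1
  isUnit s hs := hj.isUnit _ ((map_mem_nonZeroDivisors_iff_of_bijective hφ).2 hs)
  exists_denom z := by
    obtain ⟨s, hs, t, ht⟩ := hj.exists_denom z
    obtain ⟨s, rfl⟩ := hφ.2 s
    obtain ⟨t, rfl⟩ := hφ.2 t
    exact ⟨s, (map_mem_nonZeroDivisors_iff_of_bijective hφ).1 hs, t, ht⟩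

theorem nonempty_oreSet_nonZeroDivisors {T : Type*} [Ring T]
    (h : ∀ r, ∀ s ∈ T⁰, ∃ s' ∈ T⁰, ∃ r', s' * r = r' * s) :
    Nonempty (OreLocalization.OreSet T⁰) := by
  refine OreLocalization.nonempty_oreSet_iff.2 ⟨fun r₁ r₂ s hs => ⟨1, ?_⟩, fun r s => ?_⟩
  · rw [← sub_eq_zero, ← sub_mul] at hs
    rw [sub_eq_zero.1 (s.2.2 _ hs)]
  · obtain ⟨s', hs', r', hr'⟩ := h r s s.2
    exact ⟨r', ⟨s', hs'⟩, hr'⟩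

/-- The canonical map to the Ore localization, as an algebra map. -/
noncomputable def numeratorAlgHom (k T : Type*) [Field k] [Ring T] [Algebra k T]
    [OreLocalization.OreSet T⁰] : T →ₐ[k] OreLocalization T⁰ T :=
  { (OreLocalization.numeratorRingHom : T →+* OreLocalization T⁰ T) with
    commutes' := fun _ => rfl }

theorem numeratorAlgHom_mem_center {k T : Type*} [Field k] [Ring T] [Algebra k T]
    [OreLocalization.OreSet T⁰] {w : T} (hw : ∀ t, Commute w t) :
    numeratorAlgHom k T w ∈ Subalgebra.center k (OreLocalization T⁰ T) := by
  have hj := isLeftFractionRing_numeratorRingHom T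
  rw [Subalgebra.mem_center_iff]
  intro z
  obtain ⟨s, hs, t, hst⟩ := hj.exists_denom z
  change numeratorAlgHom k T s * z = numeratorAlgHom k T t at hst
  refine (hj.isUnit s hs).mul_left_cancel ?_
  change numeratorAlgHom k T s * _ = numeratorAlgHom k T s * _
  rw [← mul_assoc, hst, ← mul_assoc, ← map_mul, ← map_mul, ← (hw s).eq, ← (hw t).eq, map_mul,
    map_mul, mul_assoc, hst]

end OreLocalization

/-! ### Prime and maximal two-sided ideals -/

section TwoSided

variable {S : Type*} [Ring S] {P : TwoSidedIdeal S}

/-- The elementwise form of primeness. -/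
theorem IsPrimeTwoSided.mem_or_mem (hP : IsPrimeTwoSided P) {a b : S}
    (h : ∀ t, a * t * b ∈ P) : a ∈ P ∨ b ∈ P := by
  let J : TwoSidedIdeal S := TwoSidedIdeal.mk' {u | ∀ t, u * t * b ∈ P}
    (fun t => by simp [P.zero_mem])
    (fun hx hy t => by rw [add_mul, add_mul]; exact P.add_mem (hx t) (hy t))
    (fun hx t => by rw [neg_mul, neg_mul]; exact P.neg_mem (hx t))
    (fun {x y} hy t => by rw [mul_assoc x, mul_assoc x]; exact P.mul_mem_left _ _ (hy t))
    (fun {x y} hx t => by rw [mul_assoc x]; exact hx (y * t))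
  have hJ : ∀ u, u ∈ J ↔ ∀ t, u * t * b ∈ P := fun u => by
    rw [TwoSidedIdeal.mem_mk']
    rfl
  let L : TwoSidedIdeal S := TwoSidedIdeal.mk' {v | ∀ u ∈ J, ∀ t, u * t * v ∈ P}
    (fun u _ t => by simp [P.zero_mem])
    (fun hx hy u hu t => by rw [mul_add]; exact P.add_mem (hx u hu t) (hy u hu t))
    (fun hx u hu t => by rw [mul_neg]; exact P.neg_mem (hx u hu t))
    (fun {x y} hy u hu t => by rw [← mul_assoc, mul_assoc u]; exact hy u hu (t * x))
    (fun {x y} hx u hu t => by rw [← mul_assoc]; exact P.mul_mem_right _ _ (hx u hu t))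
  have hL : ∀ v, v ∈ L ↔ ∀ u ∈ J, ∀ t, u * t * v ∈ P := fun v => by
    rw [TwoSidedIdeal.mem_mk']
    rfl
  refine (hP.2 J L fun u hu v hv => ?_).imp (fun hJP => hJP ((hJ a).2 h))
    (fun hLP => hLP ((hL b).2 fun u hu => (hJ u).1 hu))
  simpa using (hL v).1 hv u hu 1

theorem mk_eq_zero_iff {s : S} : Ideal.Quotient.mk P.asIdeal s = 0 ↔ s ∈ P := by
  rw [Ideal.Quotient.eq_zero_iff_mem, TwoSidedIdeal.mem_asIdeal]

theorem one_notMem_of_ne_top (hP : P ≠ ⊤) : (1 : S) ∉ P := fun h =>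
  hP (top_le_iff.1 fun x _ => by simpa using P.mul_mem_left x 1 h)

theorem isMaximalTwoSided_iff (hP : P ≠ ⊤) : IsMaximalTwoSided P ↔
    ∀ J : TwoSidedIdeal (S ⧸ P.asIdeal), ∀ s ∈ J, s ≠ 0 → (1 : S ⧸ P.asIdeal) ∈ J := by
  constructor
  · intro hmax J s hs hs0
    obtain ⟨s, rfl⟩ := Ideal.Quotient.mk_surjective s
    have hlt : P < J.comap (Ideal.Quotient.mk P.asIdeal) := by
      refine lt_of_le_of_ne (fun x hx => ?_) fun heq => hs0 (mk_eq_zero_iff.2 ?_)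
      · rw [TwoSidedIdeal.mem_comap, mk_eq_zero_iff.2 hx]
        exact J.zero_mem
      · rw [heq, TwoSidedIdeal.mem_comap]
        exact hs
    have h1 : (1 : S) ∈ J.comap (Ideal.Quotient.mk P.asIdeal) := by
      rw [hmax.2 _ hlt]
      trivial
    rwa [TwoSidedIdeal.mem_comap, map_one] at h1
  · refine fun h => ⟨hP, fun K hK => ?_⟩
    obtain ⟨hle, s, hsK, hsP⟩ := SetLike.lt_iff_le_and_exists.1 hK
    let J : TwoSidedIdeal (S ⧸ P.asIdeal) :=
      TwoSidedIdeal.mk' {y | ∃ x ∈ K, Ideal.Quotient.mk P.asIdeal x = y}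
        ⟨0, K.zero_mem, map_zero _⟩
        (by
          rintro _ _ ⟨x, hx, rfl⟩ ⟨y, hy, rfl⟩
          exact ⟨x + y, K.add_mem hx hy, map_add _ _ _⟩)
        (by
          rintro _ ⟨x, hx, rfl⟩
          exact ⟨-x, K.neg_mem hx, map_neg _ _⟩)
        (by
          rintro y _ ⟨x, hx, rfl⟩
          obtain ⟨y, rfl⟩ := Ideal.Quotient.mk_surjective y
          exact ⟨y * x, K.mul_mem_left _ _ hx, map_mul _ _ _⟩)
        (by
          rintro _ y ⟨x, hx, rfl⟩
          obtain ⟨y, rfl⟩ := Ideal.Quotient.mk_surjective y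
          exact ⟨x * y, K.mul_mem_right _ _ hx, map_mul _ _ _⟩)
    have hJ : ∀ y, y ∈ J ↔ ∃ x ∈ K, Ideal.Quotient.mk P.asIdeal x = y := fun y => by
      rw [TwoSidedIdeal.mem_mk']
      rfl
    obtain ⟨x, hx, hx1⟩ := (hJ 1).1 (h J _ ((hJ _).2 ⟨s, hsK, rfl⟩) (mt mk_eq_zero_iff.1 hsP))
    have h1x : 1 - x ∈ P := by
      rw [← mk_eq_zero_iff, map_sub, map_one, hx1, sub_self]
    have h1 : (1 : S) ∈ K := by simpa using K.add_mem (hle h1x) hx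
    by_contra hK
    exact one_notMem_of_ne_top hK h1

end TwoSided

/-! ### The factor ring `S / P` -/

namespace SkewLaurent

section Quotient

variable {k R : Type*} [Field k] [CommRing R] [Algebra k R] {σ : R ≃ₐ[k] R}
  (P : TwoSidedIdeal (SkewLaurent σ))

/-- The embedding of `R / (P ∩ R)` into `S / P`. -/
noncomputable def quotientC : (R ⧸ contraction σ P) →ₐ[k] (SkewLaurent σ ⧸ P.asIdeal) :=
  Ideal.Quotient.liftₐ _
    { (Ideal.Quotient.mk P.asIdeal).comp (C σ) with commutes' := fun _ => rfl }
    fun r hr => by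
      change Ideal.Quotient.mk P.asIdeal (C σ r) = 0
      rw [mk_eq_zero_iff]
      exact hr

theorem quotientC_mk (r : R) : quotientC P (Ideal.Quotient.mk _ r) =
    Ideal.Quotient.mk P.asIdeal (C σ r) := rfl

theorem quotientC_injective : Function.Injective (quotientC P) := by
  rw [injective_iff_map_eq_zero]
  intro a ha
  obtain ⟨r, rfl⟩ := Ideal.Quotient.mk_surjective a
  rw [quotientC_mk, mk_eq_zero_iff] at ha
  exact Ideal.Quotient.eq_zero_iff_mem.2 ha

theorem inducedAut_mk (r : R) : inducedAut σ P (Ideal.Quotient.mk _ r) =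
    Ideal.Quotient.mk _ (σ r) := rfl

/-- The image of the variable `x` in `S / P`, as a unit. -/
noncomputable def quotientX : (SkewLaurent σ ⧸ P.asIdeal)ˣ :=
  Units.map (Ideal.Quotient.mk P.asIdeal).toMonoidHom (X σ)

theorem quotientX_mul_quotientC (a : R ⧸ contraction σ P) :
    (quotientX P : SkewLaurent σ ⧸ P.asIdeal) * quotientC P a =
      quotientC P (inducedAut σ P a) * quotientX P := by
  obtain ⟨r, rfl⟩ := Ideal.Quotient.mk_surjective a
  rw [inducedAut_mk, quotientC_mk, quotientC_mk]
  change Ideal.Quotient.mk P.asIdeal (X σ) * _ = _ * Ideal.Quotient.mk P.asIdeal (X σ)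
  rw [← map_mul, X_mul_C, map_mul]

/-- The canonical map from the skew Laurent polynomial ring over `R / (P ∩ R)` to `S / P`. -/
noncomputable def toQuotient : SkewLaurent (inducedAut σ P) →ₐ[k] (SkewLaurent σ ⧸ P.asIdeal) :=
  lift (quotientC P) (quotientX P) (quotientX_mul_quotientC P)

theorem toQuotient_C (a : R ⧸ contraction σ P) : toQuotient P (C _ a) = quotientC P a :=
  lift_C _ _ _ a

/-- Every element of `S` has the same image in `S / P` as its reduction modulo `P ∩ R`. -/
theorem exists_toQuotient_eq (f : SkewLaurent σ) : ∃ g : SkewLaurent (inducedAut σ P),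
    toQuotient P g = Ideal.Quotient.mk P.asIdeal f ∧
      ∀ n, coeff _ g n = Ideal.Quotient.mk _ (coeff σ f n) := by
  induction f using induction_monomial with
  | ha f f' hf hf' =>
    obtain ⟨g, hg, hgn⟩ := hf
    obtain ⟨g', hg', hgn'⟩ := hf'
    exact ⟨g + g', by rw [map_add, hg, hg', map_add], fun n => by
      rw [map_add, Finsupp.add_apply, hgn, hgn', map_add, Finsupp.add_apply, map_add]⟩
  | hm n r =>
    refine ⟨monomial _ n (Ideal.Quotient.mk _ r), ?_, fun i => ?_⟩
    · rw [toQuotient, lift_monomial, quotientC_mk, monomial_eq_C_mul, map_mul, ← X_zpow, quotientX,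
        ← map_zpow]
      rfl
    · rw [coeff_monomial, coeff_monomial, Finsupp.single_apply, Finsupp.single_apply]
      split_ifs
      · rfl
      · rw [map_zero]

theorem toQuotient_surjective : Function.Surjective (toQuotient P) := fun t => by
  obtain ⟨f, rfl⟩ := Ideal.Quotient.mk_surjective t
  obtain ⟨g, hg, -⟩ := exists_toQuotient_eq P f
  exact ⟨g, hg⟩

variable {P}

theorem eq_zero_or_eq_zero_of_isPrimeTwoSided (hP : IsPrimeTwoSided P)
    (a b : SkewLaurent σ ⧸ P.asIdeal) (h : ∀ t, a * t * b = 0) : a = 0 ∨ b = 0 := by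
  obtain ⟨a, rfl⟩ := Ideal.Quotient.mk_surjective a
  obtain ⟨b, rfl⟩ := Ideal.Quotient.mk_surjective b
  rw [mk_eq_zero_iff, mk_eq_zero_iff]
  refine hP.mem_or_mem fun t => ?_
  rw [← mk_eq_zero_iff, map_mul, map_mul]
  exact h _

theorem autPrime_inducedAut (hP : IsPrimeTwoSided P) : AutPrime (inducedAut σ P) := by
  intro a b h
  have key : ∀ t, quotientC P a * t * quotientC P b = 0 := fun t => by
    obtain ⟨s, rfl⟩ := toQuotient_surjective P t
    rw [← toQuotient_C, ← toQuotient_C, ← map_mul, ← map_mul]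
    suffices hz : C _ a * s * C _ b = 0 by rw [hz, map_zero]
    ext n
    rw [coeff_mul_C, coeff_C_mul, mul_right_comm, h n, zero_mul]
    simp
  simpa [map_eq_zero_iff _ (quotientC_injective P)] using
    eq_zero_or_eq_zero_of_isPrimeTwoSided hP _ _ key

/-- If the automorphism induced on `R / (P ∩ R)` has infinite order, then `S / P` is a skew Laurent
polynomial ring over `R / (P ∩ R)`. -/
theorem toQuotient_bijective (hP : IsPrimeTwoSided P)
    (hinf : ∀ i : ℤ, i ≠ 0 → inducedAut σ P ^ i ≠ 1) : Function.Bijective (toQuotient P) := by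
  refine ⟨(injective_iff_map_eq_zero _).2 fun s hs => ?_, toQuotient_surjective P⟩
  by_contra hs0
  obtain ⟨a, ha0, ha⟩ := exists_C_mem_of_ne_zero (autPrime_inducedAut hP) hinf
    (TwoSidedIdeal.ker (toQuotient P)) ((TwoSidedIdeal.mem_ker _).2 hs) hs0
  rw [TwoSidedIdeal.mem_ker, toQuotient_C, map_eq_zero_iff _ (quotientC_injective P)] at ha
  exact ha0 ha

theorem coe_eq_extension_contraction (hφ : Function.Injective (toQuotient P)) :
    (P : Set (SkewLaurent σ)) = extension σ (contraction σ P) := by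
  refine Set.Subset.antisymm (fun f hf => ?_) fun f hf => ?_
  · obtain ⟨g, hg, hgn⟩ := exists_toQuotient_eq P f
    rw [mk_eq_zero_iff.2 hf, map_eq_zero_iff _ hφ] at hg
    rw [← sum_monomial f]
    refine Submodule.sum_mem _ fun n _ => ?_
    have hmem : coeff σ f n ∈ contraction σ P := by
      rw [← Ideal.Quotient.eq_zero_iff_mem, ← hgn, hg, map_zero, Finsupp.zero_apply]
    rw [monomial_eq_C_mul]
    exact Submodule.smul_mem _ (MulOpposite.op (monomial σ n 1))
      (Submodule.subset_span ⟨_, hmem, rfl⟩)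
  · induction hf using Submodule.span_induction with
    | mem x hx =>
      obtain ⟨r, hr, rfl⟩ := hx
      exact hr
    | zero => exact P.zero_mem
    | add x y _ _ hx hy => exact P.add_mem hx hy
    | smul s x _ hx => exact P.mul_mem_right x s.unop hx

end Quotient

end SkewLaurent

/-! ### Criteria for rationality -/

section Rational

open scoped nonZeroDivisors

variable {k S : Type*} [Field k] [Ring S] [Algebra k S] {P : TwoSidedIdeal S}

theorem isRationalIdeal_of_forall_mem_center (hP : IsPrimeTwoSided P)
    (hore : ∀ r, ∀ s ∈ (S ⧸ P.asIdeal)⁰, ∃ s' ∈ (S ⧸ P.asIdeal)⁰, ∃ r', s' * r = r' * s)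
    (halg : ∀ _ : OreLocalization.OreSet (S ⧸ P.asIdeal)⁰,
      ∀ z ∈ Subalgebra.center k (OreLocalization (S ⧸ P.asIdeal)⁰ (S ⧸ P.asIdeal)),
        IsAlgebraic k z) : IsRationalIdeal k P := by
  obtain ⟨O⟩ := nonempty_oreSet_nonZeroDivisors hore
  refine ⟨hP, O, ⟨fun z => ?_⟩⟩
  rw [← isAlgebraic_algHom_iff (Subalgebra.center k _).val Subtype.val_injective]
  exact halg O z z.2

theorem IsRationalIdeal.exists_oreSet (h : IsRationalIdeal k P) :
    ∃ _ : OreLocalization.OreSet (S ⧸ P.asIdeal)⁰,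
      ∀ z ∈ Subalgebra.center k (OreLocalization (S ⧸ P.asIdeal)⁰ (S ⧸ P.asIdeal)),
        IsAlgebraic k z := by
  obtain ⟨-, O, halg⟩ := h
  refine ⟨O, fun z hz => ?_⟩
  exact (halg.isAlgebraic ⟨z, hz⟩).algHom (Subalgebra.center k _).val

theorem isRationalIdeal_of_finite (hP : IsPrimeTwoSided P) [Module.Finite k (S ⧸ P.asIdeal)] :
    IsRationalIdeal k P := by
  refine isRationalIdeal_of_forall_mem_center hP (fun r s hs => ?_) fun O z _ => ?_
  · obtain ⟨u, rfl⟩ := isUnit_of_mem_nonZeroDivisors_of_finite (k := k) hs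
    exact ⟨1, one_mem _, r * ↑u⁻¹, by rw [one_mul, Units.inv_mul_cancel_right]⟩
  · obtain ⟨s, hs, t, hst⟩ := (isLeftFractionRing_numeratorRingHom (S ⧸ P.asIdeal)).exists_denom z
    obtain ⟨u, rfl⟩ := isUnit_of_mem_nonZeroDivisors_of_finite (k := k) hs
    change numeratorAlgHom k _ _ * z = numeratorAlgHom k _ t at hst
    have hz : z = numeratorAlgHom k _ (↑u⁻¹ * t) := by
      rw [map_mul, ← hst, ← mul_assoc, ← map_mul, Units.inv_mul, map_one, one_mul]
    rw [hz]
    exact (Algebra.IsAlgebraic.isAlgebraic (R := k) (↑u⁻¹ * t)).algHom (numeratorAlgHom k _)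

end Rational

namespace SkewLaurent

open scoped nonZeroDivisors

variable {k R : Type*} [Field k] [CommRing R] [Algebra k R] {σ : R ≃ₐ[k] R}
  {P : TwoSidedIdeal (SkewLaurent σ)}

theorem exists_nonZeroDivisor_mul_eq_mul_quotient [IsNoetherianRing (R ⧸ contraction σ P)]
    (hP : IsPrimeTwoSided P) (hφ : Function.Bijective (toQuotient P))
    (r s : SkewLaurent σ ⧸ P.asIdeal) (hs : s ∈ (SkewLaurent σ ⧸ P.asIdeal)⁰) :
    ∃ s' ∈ (SkewLaurent σ ⧸ P.asIdeal)⁰, ∃ r', s' * r = r' * s := by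
  have := (autPrime_inducedAut hP).isReduced
  replace hφ : Function.Bijective (toQuotient P).toRingHom := hφ
  obtain ⟨r, rfl⟩ := hφ.2 r
  obtain ⟨s, rfl⟩ := hφ.2 s
  obtain ⟨s', hs', r', h⟩ := exists_nonZeroDivisor_mul_eq_mul _ r s
    ((map_mem_nonZeroDivisors_iff_of_bijective hφ).1 hs)
  exact ⟨_, (map_mem_nonZeroDivisors_iff_of_bijective hφ).2 hs', _, by
    rw [← map_mul, h, map_mul]⟩

theorem isLeftFractionRing_comp_toQuotient (hφ : Function.Bijective (toQuotient P))
    [OreLocalization.OreSet (SkewLaurent σ ⧸ P.asIdeal)⁰] :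
    IsLeftFractionRing
      (((numeratorAlgHom k (SkewLaurent σ ⧸ P.asIdeal)).comp (toQuotient P) :) :
        SkewLaurent (inducedAut σ P) →+*
          OreLocalization (SkewLaurent σ ⧸ P.asIdeal)⁰ (SkewLaurent σ ⧸ P.asIdeal)) :=
  (isLeftFractionRing_numeratorRingHom _).comp hφ

end SkewLaurent

/-! ### Rational prime ideals -/

theorem mainTheorem9 {k R : Type*} [Field k] [IsAlgClosed k] [CommRing R] [Algebra k R]
    [Algebra.FiniteType k R] [IsReduced R] (σ : R ≃ₐ[k] R)
    (P : TwoSidedIdeal (SkewLaurent σ)) (hP : IsPrimeTwoSided P) :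
    IsRationalIdeal k P ↔
      (IsMaximalTwoSided P ∨
        (¬ FiniteDimensional k (R ⧸ SkewLaurent.contraction σ P) ∧
          (P : Set (SkewLaurent σ)) =
            SkewLaurent.extension σ (SkewLaurent.contraction σ P) ∧
          ¬ PreservesNonconstantFibration (SkewLaurent.inducedAut σ P))) := by
  have hτ := SkewLaurent.autPrime_inducedAut hP
  have hnoeth : IsNoetherianRing (R ⧸ SkewLaurent.contraction σ P) :=
    Algebra.FiniteType.isNoetherianRing k _
  have hred := hτ.isReduced
  have h1 := one_notMem_of_ne_top hP.1
  have hntA : Nontrivial (R ⧸ SkewLaurent.contraction σ P) :=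
    Ideal.Quotient.nontrivial_iff.2 ((Ideal.ne_top_iff_one _).2 h1)
  have hntT : Nontrivial (SkewLaurent σ ⧸ P.asIdeal) :=
    (SkewLaurent.quotientC_injective P).nontrivial
  rw [isMaximalTwoSided_iff hP.1]
  by_cases hfin : IsOfFinOrder (SkewLaurent.inducedAut σ P)
  · obtain ⟨_, _, _, _⟩ := SkewLaurent.exists_finite_over_central _ hfin (SkewLaurent.toQuotient P)
      (SkewLaurent.toQuotient_surjective P)
    constructor
    · intro hrat
      obtain ⟨_, halg⟩ := hrat.exists_oreSet
      have hprime := SkewLaurent.eq_zero_or_eq_zero_of_isPrimeTwoSided hP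
      have : Module.Finite k (SkewLaurent σ ⧸ P.asIdeal) := by
        refine finite_of_forall_algebraMap_eq
          (MvPolynomial Bool (fixedSubalgebra (SkewLaurent.inducedAut σ P))) fun z => ?_
        refine exists_eq_algebraMap_of_commute hprime (fun t => Algebra.commutes z t) ?_
        refine (isAlgebraic_algHom_iff (numeratorAlgHom k _)
          (isLeftFractionRing_numeratorRingHom _).injective).1 (halg _ ?_)
        exact numeratorAlgHom_mem_center fun t => Algebra.commutes z t
      exact Or.inl fun J s hs hs0 => one_mem_of_mem_of_ne_zero (k := k) hprime J hs hs0
    · rintro (hsimple | ⟨hinf, -, hfib⟩)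
      · have := finite_of_isSimple (k := k)
          (MvPolynomial Bool (fixedSubalgebra (SkewLaurent.inducedAut σ P))) hsimple
        exact isRationalIdeal_of_finite hP
      · exact absurd (preservesNonconstantFibration_of_isOfFinOrder hτ hfin hinf) hfib
  · have hinf : ∀ i : ℤ, i ≠ 0 → SkewLaurent.inducedAut σ P ^ i ≠ 1 := fun i hi h =>
      hfin (isOfFinOrder_iff_zpow_eq_one.2 ⟨i, hi, h⟩)
    have hφ := SkewLaurent.toQuotient_bijective hP hinf
    have hore := SkewLaurent.exists_nonZeroDivisor_mul_eq_mul_quotient hP hφ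
    constructor
    · intro hrat
      obtain ⟨O, halg⟩ := hrat.exists_oreSet
      refine Or.inr ⟨fun _ => hfin (isOfFinOrder_of_finite_of_isReduced _),
        SkewLaurent.coe_eq_extension_contraction hφ.1, ?_⟩
      exact SkewLaurent.not_preservesNonconstantFibration_of_isAlgebraic hτ
        (SkewLaurent.isLeftFractionRing_comp_toQuotient hφ) halg
    · rintro (hsimple | ⟨-, -, hfib⟩)
      · refine isRationalIdeal_of_forall_mem_center hP hore fun O z hz =>
          SkewLaurent.isAlgebraic_of_isSimple hτ hinf
            (SkewLaurent.isLeftFractionRing_comp_toQuotient hφ) (fun J s hs hs0 => ?_) hz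
        let e := RingEquiv.ofBijective (SkewLaurent.toQuotient P) hφ
        have := hsimple (J.comap e.symm) (e s)
          (by rw [TwoSidedIdeal.mem_comap]; simpa using hs)
          ((map_ne_zero_iff e e.injective).2 hs0)
        rw [TwoSidedIdeal.mem_comap] at this
        simpa using this
      · exact isRationalIdeal_of_forall_mem_center hP hore fun O z hz =>
          SkewLaurent.isAlgebraic_of_not_preservesNonconstantFibration hτ hinf
            (SkewLaurent.isLeftFractionRing_comp_toQuotient hφ) hfib hz
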